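/- **Theorem.** Let $N=\{1,\dots,n\}$ with $n\ge 1$ be a set of agents and $M$ a set of $m$ indivisible items. Suppose every valuation $v_i:2^M\to\mathbb R$ is a matroid rank function: $v_i(\emptyset)=0$, $v_i(S)+v_i(T)\ge v_i(S\cup T)+v_i(S\cap T)$ for all $S,T\subseteq M$, and $v_i(S\cup\{e\})-v_i(S)\in\{0,1\}$ for all $S\subseteq M$, $e\in M$. An allocation is a partition $A=(A_1,\dots,A_n)$ of all of $M$ into $n$ (possibly empty) bundles. It is *both equitable-convertible and envy-freeable* if there is one vector of payments $p\in\mathbb R_{\ge 0}^n$ such that $v_i(A_i)+p_i=v_j(A_j)+p_j$ and $v_i(A_i)+p_i\ge v_i(A_j)+p_j$ for all $i,j\in N$. Then there is an allocation that maximizes the Nash welfare $\left(\prod_{i\in N}v_i(A_i)\right)^{1/n}$ over all allocations and is both equitable-convertible and envy-freeable, and there is an allocation that maximizes the utilitarian social welfare $\sum_{i\in N}v_i(A_i)$ over all allocations and is both equitable-convertible and envy-freeable. Moreover, an allocation of each of the two kinds can be computed in polynomial time: for each kind there are one random access machine program (unit-cost addition, truncated subtraction, comparison and random access on natural numbers,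 without multiplication) with a value oracle (given an agent $i$ and the indicator array of a bundle $S\subseteq M$, it returns $v_i(S)$ in one step) and one polynomial $q$ such that on every instance as above the program, started with $n$ and $m$, halts after at most $q(n+m)$ steps and outputs such an allocation. -/

import Mathlib

namespace FairDivision

/-! ### Instances, allocations, fairness and efficiency -/

/-- A matroid rank valuation on the finite item set `α`: normalized, submodular, and every
marginal value `v (S ∪ e) - v S` is zero or one. -/
structure IsMatroidRank {α : Type*} [DecidableEq α] (v : Finset α → ℝ) : Prop where
  empty : v ∅ = 0
  submodular : ∀ S T : Finset α, v (S ∪ T) + v (S ∩ T) ≤ v S + v T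
  marginal : ∀ (S : Finset α) (e : α), v (insert e S) - v S = 0 ∨ v (insert e S) - v S = 1

/-- A valuation profile for `n` agents and `m` items. -/
abbrev Profile (n m : ℕ) := Fin n → Finset (Fin m) → ℝ

/-- A tuple of bundles, one for each agent. -/
abbrev Bundles (n m : ℕ) := Fin n → Finset (Fin m)

/-- An allocation is an `n`-partition of all the items (with possibly empty parts). -/
structure IsAllocation {n m : ℕ} (A : Bundles n m) : Prop where
  cover : ∀ e : Fin m, ∃ i : Fin n, e ∈ A i
  disjoint : ∀ i j : Fin n, i ≠ j → Disjoint (A i) (A j)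

/-- `(A, p)` is equitable. -/
def IsEquitableWith {n m : ℕ} (v : Profile n m) (A : Bundles n m) (p : Fin n → ℝ) : Prop :=
  ∀ i j : Fin n, v i (A i) + p i = v j (A j) + p j

/-- `(A, p)` is envy-free. -/
def IsEnvyFreeWith {n m : ℕ} (v : Profile n m) (A : Bundles n m) (p : Fin n → ℝ) : Prop :=
  ∀ i j : Fin n, v i (A j) + p j ≤ v i (A i) + p i

/-- Both equitable-convertible and envy-freeable: one vector of nonnegative payments makes
the allocation both equitable and envy-free. -/
def IsEquitableConvertibleEnvyFreeable {n m : ℕ} (v : Profile n m) (A : Bundles n m) : Prop :=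
  ∃ p : Fin n → ℝ, (∀ i, 0 ≤ p i) ∧ IsEquitableWith v A p ∧ IsEnvyFreeWith v A p

/-- Utilitarian social welfare. -/
noncomputable def usw {n m : ℕ} (v : Profile n m) (A : Bundles n m) : ℝ :=
  ∑ i, v i (A i)

/-- Nash welfare: the geometric mean of the agents' values. -/
noncomputable def nsw {n m : ℕ} (v : Profile n m) (A : Bundles n m) : ℝ :=
  (∏ i, v i (A i)) ^ (1 / (n : ℝ))

/-- `A` is a maximum utilitarian social welfare allocation. -/
def IsMaxUSW {n m : ℕ} (v : Profile n m) (A : Bundles n m) : Prop :=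
  IsAllocation A ∧ ∀ B : Bundles n m, IsAllocation B → usw v B ≤ usw v A

/-- `A` is a maximum Nash welfare allocation. -/
def IsMaxNSW {n m : ℕ} (v : Profile n m) (A : Bundles n m) : Prop :=
  IsAllocation A ∧ ∀ B : Bundles n m, IsAllocation B → nsw v B ≤ nsw v A

/-- The values of a matroid rank valuation are natural numbers, so that rounding
down, which turns them into natural numbers, does not change them. -/
theorem IsMatroidRank.natCast_floor {α : Type*} [DecidableEq α] {v : Finset α → ℝ}
    (hv : IsMatroidRank v) (S : Finset α) : ((⌊v S⌋₊ : ℕ) : ℝ) = v S := by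
  have key : ∃ k : ℕ, v S = k := by
    induction S using Finset.induction_on with
    | empty => exact ⟨0, by simp [hv.empty]⟩
    | insert e S _ ih =>
      obtain ⟨k, hk⟩ := ih
      rcases hv.marginal S e with h | h
      · exact ⟨k, by linarith⟩
      · exact ⟨k + 1, by push_cast; linarith⟩
  obtain ⟨k, hk⟩ := key
  rw [hk, Nat.floor_natCast]

/-! ### Random access machines with a value oracle

Programs manipulate natural numbers held in registers and in random access arrays. The only
arithmetic is addition, truncated subtraction and comparison, each at unit cost (there is no
multiplication), so the bit length of the numbers grows by at most a constant per step, and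
time is the usual polynomial time up to a polynomial. -/

/-- The memory: registers, and arrays of natural numbers. A program refers to only finitely
many of the registers and arrays. -/
@[ext] structure Memory where
  reg : ℕ → ℕ
  arr : ℕ → ℕ → ℕ

/-- Expressions. -/
inductive Expr where
  /-- a constant -/
  | const (c : ℕ)
  /-- the content of a register -/
  | reg (x : ℕ)
  /-- the entry of array `a` at the position given by `i` -/
  | read (a : ℕ) (i : Expr)
  | add (e₁ e₂ : Expr)
  /-- truncated subtraction -/
  | sub (e₁ e₂ : Expr)
  /-- `1` if `e₁ < e₂`, and `0` otherwise -/
  | lt (e₁ e₂ : Expr)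
  /-- `1` if `e₁ = e₂`, and `0` otherwise -/
  | eq (e₁ e₂ : Expr)

/-- The value of an expression. -/
def Expr.eval (s : Memory) : Expr → ℕ
  | .const c => c
  | .reg x => s.reg x
  | .read a i => s.arr a (i.eval s)
  | .add e₁ e₂ => e₁.eval s + e₂.eval s
  | .sub e₁ e₂ => e₁.eval s - e₂.eval s
  | .lt e₁ e₂ => if e₁.eval s < e₂.eval s then 1 else 0
  | .eq e₁ e₂ => if e₁.eval s = e₂.eval s then 1 else 0

/-- The number of steps that the evaluation of an expression takes. -/
def Expr.cost : Expr → ℕ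
  | .const _ => 1
  | .reg _ => 1
  | .read _ i => i.cost + 1
  | .add e₁ e₂ => e₁.cost + e₂.cost + 1
  | .sub e₁ e₂ => e₁.cost + e₂.cost + 1
  | .lt e₁ e₂ => e₁.cost + e₂.cost + 1
  | .eq e₁ e₂ => e₁.cost + e₂.cost + 1

/-- Programs. In a branch or a loop, a condition holds if its value is not zero. -/
inductive Prog where
  | skip
  /-- store the value of `e` in register `x` -/
  | assign (x : ℕ) (e : Expr)
  /-- store the value of `e` in array `a` at the position given by `i` -/
  | write (a : ℕ) (i e : Expr)
  /-- ask the oracle for the value, to the agent given by `i`, of the bundle of those items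
  at which array `a` is not zero, and store the answer in register `x` -/
  | query (x : ℕ) (i : Expr) (a : ℕ)
  | seq (c₁ c₂ : Prog)
  /-- if `b` then `c₁` else `c₂` -/
  | branch (b : Expr) (c₁ c₂ : Prog)
  /-- while `b` do `c` -/
  | loop (b : Expr) (c : Prog)

/-- The memory after a number is stored in a register. -/
def Memory.setReg (s : Memory) (x k : ℕ) : Memory :=
  { s with reg := Function.update s.reg x k }

/-- The memory after a number is stored in an array. -/
def Memory.setArr (s : Memory) (a i k : ℕ) : Memory :=
  { s with arr := Function.update s.arr a (Function.update (s.arr a) i k) }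

/-- `Exec O c s t k`: with the oracle `O`, the program `c` started in memory `s` halts in
memory `t` after exactly `k` steps. An oracle call is a single step. -/
inductive Exec (O : ℕ → (ℕ → ℕ) → ℕ) : Prog → Memory → Memory → ℕ → Prop where
  | skip (s : Memory) : Exec O .skip s s 1
  | assign (s : Memory) (x : ℕ) (e : Expr) :
      Exec O (.assign x e) s (s.setReg x (e.eval s)) (e.cost + 1)
  | write (s : Memory) (a : ℕ) (i e : Expr) :
      Exec O (.write a i e) s (s.setArr a (i.eval s) (e.eval s)) (i.cost + e.cost + 1)
  | query (s : Memory) (x : ℕ) (i : Expr) (a : ℕ) :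
      Exec O (.query x i a) s (s.setReg x (O (i.eval s) (s.arr a))) (i.cost + 1)
  | seq {c₁ c₂ : Prog} {s t u : Memory} {k l : ℕ} :
      Exec O c₁ s t k → Exec O c₂ t u l → Exec O (.seq c₁ c₂) s u (k + l)
  | branch_true {b : Expr} {c₁ c₂ : Prog} {s t : Memory} {k : ℕ} :
      b.eval s ≠ 0 → Exec O c₁ s t k → Exec O (.branch b c₁ c₂) s t (b.cost + k + 1)
  | branch_false {b : Expr} {c₁ c₂ : Prog} {s t : Memory} {k : ℕ} :
      b.eval s = 0 → Exec O c₂ s t k → Exec O (.branch b c₁ c₂) s t (b.cost + k + 1)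
  | loop_done {b : Expr} {c : Prog} {s : Memory} :
      b.eval s = 0 → Exec O (.loop b c) s s (b.cost + 1)
  | loop_step {b : Expr} {c : Prog} {s t u : Memory} {k l : ℕ} :
      b.eval s ≠ 0 → Exec O c s t k → Exec O (.loop b c) t u l →
      Exec O (.loop b c) s u (b.cost + k + l + 1)

/-- Programs are deterministic: the final memory and the number of steps are determined by
the initial memory and the oracle. -/
theorem Exec.deterministic {O : ℕ → (ℕ → ℕ) → ℕ} {c : Prog} {s t t' : Memory} {k k' : ℕ}
    (h : Exec O c s t k) (h' : Exec O c s t' k') : t = t' ∧ k = k' := by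
  induction h generalizing t' k' with
  | skip | assign | write | query => cases h'; exact ⟨rfl, rfl⟩
  | seq _ _ ih₁ ih₂ =>
    cases h' with
    | seq a b => obtain ⟨rfl, rfl⟩ := ih₁ a; obtain ⟨rfl, rfl⟩ := ih₂ b; exact ⟨rfl, rfl⟩
  | branch_true hb _ ih =>
    cases h' with
    | branch_true _ a => obtain ⟨rfl, rfl⟩ := ih a; exact ⟨rfl, rfl⟩
    | branch_false hb' _ => exact absurd hb' hb
  | branch_false hb _ ih =>
    cases h' with
    | branch_true hb' _ => exact absurd hb hb'
    | branch_false _ a => obtain ⟨rfl, rfl⟩ := ih a; exact ⟨rfl, rfl⟩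
  | loop_done hb =>
    cases h' with
    | loop_done _ => exact ⟨rfl, rfl⟩
    | loop_step hb' _ _ => exact absurd hb hb'
  | loop_step hb _ _ ih₁ ih₂ =>
    cases h' with
    | loop_done hb' => exact absurd hb' hb
    | loop_step _ a b => obtain ⟨rfl, rfl⟩ := ih₁ a; obtain ⟨rfl, rfl⟩ := ih₂ b; exact ⟨rfl, rfl⟩

/-- The value oracle of a profile of natural-number-valued valuations: asked for agent `i` and
the bundle with indicator `f`, it returns the value of that bundle to that agent. (The value
is rounded down to a natural number, which does nothing to a matroid rank valuation; the answer
for an agent that does not exist is `0`.) -/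
noncomputable def valueOracle {n m : ℕ} (v : Profile n m) (i : ℕ) (f : ℕ → ℕ) : ℕ :=
  if h : i < n then ⌊v ⟨i, h⟩ (Finset.univ.filter fun e : Fin m => f e ≠ 0)⌋₊ else 0

/-- The initial memory: registers `0` and `1` hold the numbers of agents and of items, and
everything else is zero. -/
def initialMemory (n m : ℕ) : Memory where
  reg x := if x = 0 then n else if x = 1 then m else 0
  arr _ _ := 0

/-- The memory represents the bundles `A`: for every item, array `0` holds the agent who
gets it. -/
def Outputs {n m : ℕ} (t : Memory) (A : Bundles n m) : Prop :=
  ∀ (i : Fin n) (e : Fin m), e ∈ A i ↔ t.arr 0 e = i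

/-- Some algorithm with access to the value oracle finds, for every instance with matroid rank
valuations, an allocation with the property `Good` in time polynomial in the numbers of agents
and items. A single program and a single polynomial serve all the instances. -/
def PolyTimeComputable (Good : ∀ {n m : ℕ}, Profile n m → Bundles n m → Prop) : Prop :=
  ∃ (P : Prog) (q : Polynomial ℕ), ∀ (n m : ℕ), 0 < n →
    ∀ v : Profile n m, (∀ i, IsMatroidRank (v i)) →
      ∃ (t : Memory) (k : ℕ) (A : Bundles n m),
        Exec (valueOracle v) P (initialMemory n m) t k ∧ k ≤ q.eval (n + m) ∧
          Outputs t A ∧ IsAllocation A ∧ Good v A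

end FairDivision

/-!
Equal sums `v i (A i) + p i` reduce envy-freeness to `v i (A j) ≤ v j (A j)` for all `i` and `j`:
nobody values a bundle more than its owner does. Payments up to the common value `m` then work.
A single allocation serves both kinds of welfare. It arises from pairwise disjoint bundles `X i`
that are independent in the matroids of their owners and Lorenz dominating: for every `k` they
maximize `∑ i, min (v i (X i)) k`. Large `k` gives maximum utilitarian welfare, and Abel summation
against the decreasing increments of the logarithm gives maximum Nash welfare
(`prod_le_prod_of_sum_min_le`).

The dual certificate for the truncation at `k` is a set `R` of items that contains all unassigned
items and satisfies `min (v i R) k = |X i ∩ R|` for every agent `i` (`IsCertificate`). For `k = m`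
it also shows where the unassigned items can go: if `J` maximizes `|X J ∩ R|`, then all of them can
be given to `J` without anybody valuing the resulting bundle at more than `|X J|`
(`exists_completion`).

The bundles are computed by a push-relabel algorithm for matroid partition, for the ranks truncated
at `k = 0, …, m` in turn. Items carry levels, subject to the invariant `IsLevel`. An unassigned
item is added to a bundle, or replaces an item exactly one level lower, or is relabeled. A single
exchange of this kind keeps the levels valid (`IsLevel.swap`), so that no shortest augmenting paths
are needed, and a potential bounds the number of steps. When all unassigned items are above level
`m`, the `m` items leave a level in `{0, …, m}` empty, and the items above it form a certificate
(`IsLevel.rank_above_gap`). No step makes a bundle smaller, so that optimality at earlier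
truncations persists and the final bundles are Lorenz dominating.

Programs are verified by rules for total correctness with a time bound (`Runs`), together with the
fact that a program changes only the registers and arrays it writes to (`Frame`).
-/

namespace FairDivision

/-! ### Matroid rank functions and level functions -/

/-- A matroid rank function with values in the natural numbers. -/
structure IsNatRank {α : Type*} [DecidableEq α] (r : Finset α → ℕ) : Prop where
  empty : r ∅ = 0
  submodular : ∀ S T : Finset α, r (S ∪ T) + r (S ∩ T) ≤ r S + r T
  le_insert : ∀ (S : Finset α) (e : α), r S ≤ r (insert e S)
  insert_le : ∀ (S : Finset α) (e : α), r (insert e S) ≤ r S + 1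

section Rank

variable {α : Type*} [DecidableEq α] {r : Finset α → ℕ}

theorem IsMatroidRank.isNatRank {v : Finset α → ℝ} (hv : IsMatroidRank v) :
    IsNatRank fun S => ⌊v S⌋₊ where
  empty := by simp [hv.empty]
  submodular S T := by
    have h := hv.submodular S T
    rw [← hv.natCast_floor S, ← hv.natCast_floor T, ← hv.natCast_floor (S ∪ T),
      ← hv.natCast_floor (S ∩ T)] at h
    exact_mod_cast h
  le_insert S e := by
    apply Nat.floor_mono
    rcases hv.marginal S e with h | h <;> linarith
  insert_le S e := by
    have h : v (insert e S) ≤ v S + 1 := by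
      rcases hv.marginal S e with h | h <;> linarith
    rw [← hv.natCast_floor S, ← hv.natCast_floor (insert e S)] at h
    exact_mod_cast h

theorem isNatRank_zero : IsNatRank fun _ : Finset α => 0 := by
  constructor <;> simp

theorem IsNatRank.mono (hr : IsNatRank r) {S T : Finset α} (h : S ⊆ T) : r S ≤ r T := by
  rw [← Finset.union_sdiff_of_subset h]
  induction T \ S using Finset.induction_on with
  | empty => simp
  | insert e D _ ih =>
    rw [Finset.union_insert]
    exact ih.trans (hr.le_insert _ _)

theorem IsNatRank.union_le (hr : IsNatRank r) (S D : Finset α) : r (S ∪ D) ≤ r S + D.card := by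
  induction D using Finset.induction_on with
  | empty => simp
  | insert e D he ih =>
    rw [Finset.union_insert, Finset.card_insert_of_notMem he]
    have := hr.insert_le (S ∪ D) e
    omega

theorem IsNatRank.le_card (hr : IsNatRank r) (S : Finset α) : r S ≤ S.card := by
  simpa [hr.empty] using hr.union_le ∅ S

/-- A subset of an independent set is independent. -/
theorem IsNatRank.indep_subset (hr : IsNatRank r) {S T : Finset α} (h : S ⊆ T)
    (hT : r T = T.card) : r S = S.card := by
  have h1 := hr.union_le S (T \ S)
  rw [Finset.union_sdiff_of_subset h, hT] at h1
  have h2 := Finset.card_sdiff_add_card_eq_card h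
  have h3 := hr.le_card S
  omega

/-- Adding a set of elements of the closure of `S` does not change the rank. -/
theorem IsNatRank.union_eq (hr : IsNatRank r) {S : Finset α} (D : Finset α)
    (h : ∀ f ∈ D, r (insert f S) = r S) : r (S ∪ D) = r S := by
  induction D using Finset.induction_on with
  | empty => simp
  | insert e D _ ih =>
    have ih := ih fun f hf => h f (Finset.mem_insert_of_mem hf)
    have h1 := hr.submodular (S ∪ D) (insert e S)
    have h2 : (S ∪ D) ∪ insert e S = S ∪ insert e D := by ext; simp; tauto
    have h3 : r S ≤ r ((S ∪ D) ∩ insert e S) := hr.mono fun a ha => by simp [ha]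
    have h4 : r S ≤ r (S ∪ insert e D) := hr.mono Finset.subset_union_left
    rw [h2, ih, h e (Finset.mem_insert_self _ _)] at h1
    omega

/-- The truncation of a matroid. -/
theorem IsNatRank.truncate (hr : IsNatRank r) (k : ℕ) : IsNatRank fun S => min (r S) k where
  empty := by simp [hr.empty]
  submodular S T := by
    have h1 := hr.submodular S T
    have h2 : r S ≤ r (S ∪ T) := hr.mono Finset.subset_union_left
    have h3 : r T ≤ r (S ∪ T) := hr.mono Finset.subset_union_right
    have h4 : r (S ∩ T) ≤ r S := hr.mono Finset.inter_subset_left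
    have h5 : r (S ∩ T) ≤ r T := hr.mono Finset.inter_subset_right
    change min _ k + min _ k ≤ min _ k + min _ k
    omega
  le_insert S e := by have := hr.le_insert S e; omega
  insert_le S e := by have := hr.insert_le S e; omega

/-- A valid level function for an independent set `S`: elements that can be added to `S` have
level zero, and an element that can replace `x` in `S` is at most one level above `x`. -/
structure IsLevel (r : Finset α → ℕ) (S : Finset α) (lev : α → ℕ) : Prop where
  indep : r S = S.card
  add : ∀ f ∉ S, r (insert f S) = S.card + 1 → lev f = 0
  exchange : ∀ f ∉ S, ∀ x ∈ S, r (insert f (S.erase x)) = S.card → lev f ≤ lev x + 1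

variable {S : Finset α} {lev : α → ℕ}

theorem isLevel_zero (h : r S = S.card) : IsLevel r S fun _ => 0 :=
  ⟨h, fun _ _ _ => rfl, fun _ _ _ _ _ => Nat.zero_le _⟩

theorem IsLevel.of_add (hr : IsNatRank r) (h : IsLevel r S lev) {e : α} (he : e ∉ S)
    (hi : r (insert e S) = S.card + 1) : IsLevel r (insert e S) lev := by
  have hadd : ∀ f ∉ S, r (insert f (insert e S)) = S.card + 2 → f ≠ e →
      lev f = 0 := by
    intro f hf hrf hne
    refine h.add f hf ?_
    rw [hr.indep_subset (T := insert f (insert e S))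
      (Finset.insert_subset_insert _ (Finset.subset_insert _ _)),
      Finset.card_insert_of_notMem hf]
    rw [hrf, Finset.card_insert_of_notMem (by simp [hne, hf]), Finset.card_insert_of_notMem he]
  refine ⟨by rw [hi, Finset.card_insert_of_notMem he], ?_, ?_⟩
  · intro f hf hrf
    rw [Finset.card_insert_of_notMem he] at hrf
    simp only [Finset.mem_insert, not_or] at hf
    exact hadd f hf.2 hrf hf.1
  · intro f hf x hx hrf
    rw [Finset.card_insert_of_notMem he] at hrf
    simp only [Finset.mem_insert, not_or] at hf
    rcases eq_or_ne x e with rfl | hxe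
    · rw [Finset.erase_insert he] at hrf
      simp [h.add f hf.2 hrf]
    · have hxS : x ∈ S := by simpa [hxe] using hx
      refine h.exchange f hf.2 x hxS ?_
      have hc := Finset.card_erase_add_one hxS
      rw [hr.indep_subset (T := insert f ((insert e S).erase x))
        (Finset.insert_subset_insert _ (Finset.erase_subset_erase _ (Finset.subset_insert _ _))),
        Finset.card_insert_of_notMem (by simp [hf.2]), hc]
      rw [hrf, Finset.card_insert_of_notMem (by simp [hf]),
        Finset.erase_insert_of_ne hxe.symm, Finset.card_insert_of_notMem (by simp [he]), hc]

/-- Replacing `x` by an element exactly one level above `x` keeps the level function valid. The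
restriction to one level is what makes single exchanges safe, where an unrestricted sequence of
exchanges would have to follow a shortest path. -/
theorem IsLevel.swap (hr : IsNatRank r) (h : IsLevel r S lev) {e x : α} (he : e ∉ S)
    (hx : x ∈ S) (hl : lev x + 1 = lev e) (hi : r (insert e (S.erase x)) = S.card) :
    IsLevel r (insert e (S.erase x)) lev := by
  have hcx := Finset.card_erase_add_one hx
  have hcard : (insert e (S.erase x)).card = S.card := by
    rw [Finset.card_insert_of_notMem (by simp [he]), hcx]
  have hecl : r (insert e S) = r S := by
    have h1 := hr.insert_le S e
    have h2 := hr.le_insert S e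
    have h3 : r (insert e S) ≠ S.card + 1 := fun hh => by
      have := h.add e he hh
      omega
    have := h.indep
    omega
  refine ⟨by rw [hi, hcard], ?_, ?_⟩
  · intro f hf hrf
    rw [hcard] at hrf
    have h1 : r (insert f (insert e (S.erase x))) ≤ r (S ∪ {e, f}) :=
      hr.mono fun a ha => by simp at ha ⊢; tauto
    have hfS : r (insert f S) ≠ r S := by
      intro hh
      have h2 := hr.union_eq (S := S) {e, f} (by simp [hecl, hh])
      have := h.indep
      omega
    have hf' : f ∉ S := fun hf' => hfS (by rw [Finset.insert_eq_of_mem hf'])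
    refine h.add f hf' ?_
    have h3 := hr.insert_le S f
    have h4 := hr.le_insert S f
    have := h.indep
    omega
  · intro f hf y hy hrf
    rw [hcard] at hrf
    simp only [Finset.mem_insert, Finset.mem_erase, not_or, not_and] at hf
    rcases eq_or_ne y e with rfl | hye
    · rw [Finset.erase_insert (by simp [he])] at hrf
      rcases eq_or_ne f x with rfl | hfx
      · omega
      · have := h.exchange f (hf.2 hfx) x hx hrf
        omega
    · have hyS : y ∈ S ∧ y ≠ x := by
        simp only [Finset.mem_insert, Finset.mem_erase, hye, false_or] at hy
        exact ⟨hy.2, hy.1⟩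
      have hcy := Finset.card_erase_add_one hyS.1
      rw [Finset.erase_insert_of_ne hye.symm] at hrf
      rcases eq_or_ne f x with rfl | hfx
      · have h1 : insert f (insert e ((S.erase f).erase y)) =
            insert e (S.erase y) := by
          ext a
          have := hyS.2
          simp only [Finset.mem_insert, Finset.mem_erase]
          by_cases haf : a = f
          · subst haf; simp [hx, this.symm]
          · simp [haf]
        rw [h1] at hrf
        have := h.exchange e he y hyS.1 hrf
        omega
      · have hfS := hf.2 hfx
        by_cases hfy : r (insert f (S.erase y)) = S.card
        · exact h.exchange f hfS y hyS.1 hfy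
        have hry : r (S.erase y) = (S.erase y).card :=
          hr.indep_subset (Finset.erase_subset _ _) h.indep
        have hfy' : r (insert f (S.erase y)) = r (S.erase y) := by
          have h1 := hr.insert_le (S.erase y) f
          have h2 := hr.le_insert (S.erase y) f
          omega
        have hey : r (insert e (S.erase y)) = S.card := by
          have h1 := hr.insert_le (S.erase y) e
          have h2 := hr.le_insert (S.erase y) e
          by_contra hne
          have h3 := hr.union_eq (S := S.erase y) {e, f} (by simp [hfy']; omega)
          have h4 : r (insert f (insert e ((S.erase x).erase y))) ≤
            r (S.erase y ∪ {e, f}) := hr.mono fun a ha => by simp at ha ⊢; tauto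
          omega
        have h5 := h.exchange e he y hyS.1 hey
        have hfx' : r (insert f (S.erase x)) = S.card := by
          have h1 := hr.submodular (insert f (S.erase x)) (insert f (S.erase y))
          have h2 : r S ≤ r (insert f (S.erase x) ∪ insert f (S.erase y)) := by
            refine hr.mono fun a ha => ?_
            have := hyS.2
            by_cases hax : a = x
            · subst hax; simp [ha, this.symm]
            · simp [ha, hax]
          have h3 : insert f (S.erase x) ∩ insert f (S.erase y) =
              insert f ((S.erase x).erase y) := by
            ext a; simp; tauto
          have h4 : r (insert f ((S.erase x).erase y)) =
              (insert f ((S.erase x).erase y)).card := by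
            refine hr.indep_subset (T := insert f (insert e ((S.erase x).erase y)))
              (Finset.insert_subset_insert _ (Finset.subset_insert _ _)) ?_
            have hyx : y ∈ S.erase x := by simp [hyS]
            have := Finset.card_erase_add_one hyx
            rw [hrf, Finset.card_insert_of_notMem (by simp [hf.1, hfS]),
              Finset.card_insert_of_notMem (by simp [he])]
            omega
          have hyx : y ∈ S.erase x := by simp [hyS]
          have h6 := Finset.card_erase_add_one hyx
          rw [h3, h4, Finset.card_insert_of_notMem (by simp [hfS])] at h1
          have h7 := hr.le_card (insert f (S.erase x))
          rw [Finset.card_insert_of_notMem (by simp [hfS])] at h7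
          have := h.indep
          omega
        have h8 := h.exchange f hfS x hx hfx'
        omega

theorem IsLevel.relabel (h : IsLevel r S lev) {e : α} (he : e ∉ S)
    (ha : r (insert e S) ≠ S.card + 1)
    (hx : ∀ x ∈ S, lev x + 1 = lev e → r (insert e (S.erase x)) ≠ S.card) :
    IsLevel r S (Function.update lev e (lev e + 1)) := by
  refine ⟨h.indep, ?_, ?_⟩
  · intro f hf hrf
    have hfe : f ≠ e := fun hh => ha (hh ▸ hrf)
    rw [Function.update_of_ne hfe]
    exact h.add f hf hrf
  · intro f hf x hxS hrf
    have hxe : x ≠ e := fun hh => he (hh ▸ hxS)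
    rw [Function.update_of_ne hxe]
    have h1 := h.exchange f hf x hxS hrf
    rcases eq_or_ne f e with rfl | hfe
    · have := hx x hxS
      simp only [Function.update_self]
      have h2 : lev x + 1 ≠ lev f := fun hh => this hh hrf
      omega
    · rwa [Function.update_of_ne hfe]

/-- If no element has level `g`, then `S` contains a basis of the set of the elements above
level `g`. -/
theorem IsLevel.rank_above_gap [Fintype α] (hr : IsNatRank r) (h : IsLevel r S lev) {g : ℕ}
    (hg : ∀ f, lev f ≠ g) :
    r (Finset.univ.filter fun f => g < lev f) = (S.filter fun f => g < lev f).card := by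
  have hind : r (S.filter fun f => g < lev f) = (S.filter fun f => g < lev f).card :=
    hr.indep_subset (Finset.filter_subset _ _) h.indep
  have key : ∀ f, g < lev f → r (insert f (S.filter fun f => g < lev f)) =
      r (S.filter fun f => g < lev f) := by
    intro f hf
    by_cases hfS : f ∈ S
    · rw [Finset.insert_eq_of_mem (by simp [hf, hfS])]
    have hfcl : r (insert f S) = S.card := by
      have h1 := hr.insert_le S f
      have h2 := hr.le_insert S f
      have h3 : r (insert f S) ≠ S.card + 1 := fun hh => by
        have := h.add f hfS hh
        omega
      have := h.indep
      omega
    -- The closures of the sets `S.erase x` with `x` below the gap all contain `f`; hence so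
    -- does the closure of their intersection.
    have hD : ∀ D ⊆ S.filter (fun x => ¬ g < lev x),
        r (insert f (S \ D)) + D.card ≤ S.card := by
      intro D
      induction D using Finset.induction_on with
      | empty => simp [hfcl]
      | insert x D hxD ih =>
        intro hsub
        have ih := ih ((Finset.subset_insert _ _).trans hsub)
        have hx := hsub (Finset.mem_insert_self _ _)
        simp only [Finset.mem_filter] at hx
        have hcx := Finset.card_erase_add_one hx.1
        have hex : r (insert f (S.erase x)) + 1 ≤ S.card := by
          have h1 := hr.insert_le (S.erase x) f
          have h2 : r (insert f (S.erase x)) ≠ S.card := fun hh => by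
            have h3 := h.exchange f hfS x hx.1 hh
            have h4 := hg x
            omega
          have h3 := hr.le_card (S.erase x)
          omega
        have h1 := hr.submodular (insert f (S \ D)) (insert f (S.erase x))
        have h2 : insert f (S \ D) ∩ insert f (S.erase x) =
            insert f (S \ insert x D) := by
          ext a; simp; tauto
        have h3 : r S ≤ r (insert f (S \ D) ∪ insert f (S.erase x)) := by
          refine hr.mono fun a ha => ?_
          by_cases hax : a = x
          · subst hax; simp [ha, hxD]
          · simp [ha, hax]
        rw [h2] at h1
        rw [Finset.card_insert_of_notMem hxD]
        have := h.indep
        omega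
    have h1 := hD _ subset_rfl
    have h2 : S \ S.filter (fun x => ¬ g < lev x) = S.filter fun x => g < lev x := by
      ext a; simp; tauto
    have h3 := Finset.card_filter_add_card_filter_not (s := S) fun x => g < lev x
    rw [h2] at h1
    have h4 := hr.le_insert (S.filter fun x => g < lev x) f
    omega
  have h5 := hr.union_eq (S := S.filter fun f => g < lev f) (Finset.univ.filter fun f => g < lev f)
    (by simpa using key)
  rw [Finset.union_eq_right.2 (Finset.filter_subset_filter _ (Finset.subset_univ _))] at h5
  rw [h5, hind]

end Rank

/-! ### Lorenz dominance -/

/-- Abel summation: nonnegative partial sums stay nonnegative after weighting the terms by a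
nonincreasing nonnegative sequence. -/
theorem sum_mul_nonneg_of_antitone {d c : ℕ → ℝ} (hd : Antitone d) (hd0 : ∀ k, 0 ≤ d k) (N : ℕ)
    (hc : ∀ K ≤ N, 0 ≤ ∑ k ∈ Finset.range K, c k) : 0 ≤ ∑ k ∈ Finset.range N, d k * c k := by
  have key : ∀ K ≤ N,
      d K * ∑ k ∈ Finset.range K, c k ≤ ∑ k ∈ Finset.range K, d k * c k := by
    intro K
    induction K with
    | zero => simp
    | succ K ih =>
      intro hK
      have h1 := ih (by omega)
      have h2 := mul_le_mul_of_nonneg_right (hd (Nat.le_succ K)) (hc (K + 1) hK)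
      rw [Finset.sum_range_succ] at h2 ⊢
      rw [Finset.sum_range_succ, mul_add] at *
      linarith
  exact (mul_nonneg (hd0 N) (hc N le_rfl)).trans (key N le_rfl)

/-- The increments of the function `a ↦ 1 + log a` (for `a ≥ 1`), extended by `0` at `a = 0`. -/
noncomputable def logIncrement (k : ℕ) : ℝ :=
  if k = 0 then 1 else Real.log (k + 1) - Real.log k

theorem logIncrement_nonneg (k : ℕ) : 0 ≤ logIncrement k := by
  unfold logIncrement
  split_ifs with h
  · exact zero_le_one
  · have : (0 : ℝ) < k := by positivity
    exact sub_nonneg.2 (Real.log_le_log this (by linarith))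

theorem logIncrement_antitone : Antitone logIncrement := by
  refine antitone_nat_of_succ_le fun k => ?_
  rcases Nat.eq_zero_or_pos k with rfl | hk
  · have := Real.log_two_lt_d9
    norm_num [logIncrement]
    linarith
  · have hk' : (0 : ℝ) < k := by exact_mod_cast hk
    simp only [logIncrement, hk.ne', if_false, Nat.succ_ne_zero]
    push_cast
    have h : Real.log ((k : ℝ) + 1 + 1) + Real.log k ≤ Real.log (k + 1) + Real.log (k + 1) := by
      rw [← Real.log_mul (by positivity) (by positivity),
        ← Real.log_mul (by positivity) (by positivity)]
      exact Real.log_le_log (by positivity) (by nlinarith)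
    linarith

theorem sum_logIncrement {a : ℕ} (ha : 0 < a) :
    ∑ k ∈ Finset.range a, logIncrement k = 1 + Real.log a := by
  induction a, ha using Nat.le_induction with
  | base => simp [logIncrement]
  | succ a ha ih =>
    rw [Finset.sum_range_succ, ih, logIncrement, if_neg (by omega)]
    push_cast
    ring

variable {n m : ℕ}

/-- A Lorenz dominating vector has the larger product. -/
theorem prod_le_prod_of_sum_min_le {x y : Fin n → ℕ} {N : ℕ} (hx : ∀ i, x i ≤ N)
    (hy : ∀ i, y i ≤ N) (h : ∀ k ≤ N, ∑ i, min (y i) k ≤ ∑ i, min (x i) k) :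
    ∏ i, y i ≤ ∏ i, x i := by
  by_cases hy0 : ∃ i, y i = 0
  · obtain ⟨i, hi⟩ := hy0
    rw [Finset.prod_eq_zero (Finset.mem_univ i) hi]
    exact Nat.zero_le _
  have hypos : ∀ i, 0 < y i := fun i => Nat.pos_of_ne_zero fun hi => hy0 ⟨i, hi⟩
  -- Dominance at the threshold `1` transfers positivity from `y` to `x`.
  have hxpos : ∀ i, 0 < x i := by
    intro i
    by_contra hi
    have h1 := h 1 ((hypos i).trans_le (hy i))
    have h2 : ∑ i, min (x i) 1 < ∑ i, min (y i) 1 := by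
      refine Finset.sum_lt_sum (fun j _ => ?_) ⟨i, Finset.mem_univ i, ?_⟩
      · have := hypos j; omega
      · have := hypos i; omega
    omega
  have expand : ∀ z : Fin n → ℕ, (∀ i, 0 < z i) → (∀ i, z i ≤ N) →
      Real.log ((∏ i, z i : ℕ) : ℝ) + n =
        ∑ k ∈ Finset.range N, logIncrement k * ∑ i, if k < z i then (1 : ℝ) else 0 := by
    intro z hz hzN
    simp_rw [Finset.mul_sum]
    rw [Finset.sum_comm]
    push_cast
    rw [Real.log_prod fun i _ => by have := hz i; positivity]
    have h1 : ∀ i, ∑ k ∈ Finset.range N, logIncrement k * (if k < z i then (1 : ℝ) else 0) =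
        1 + Real.log (z i) := by
      intro i
      rw [← sum_logIncrement (hz i)]
      simp only [mul_ite, mul_one, mul_zero]
      rw [← Finset.sum_filter]
      congr 1
      ext k
      have := hzN i
      simp only [Finset.mem_filter, Finset.mem_range]
      omega
    simp only [h1, Finset.sum_add_distrib, Finset.sum_const, Finset.card_univ, Fintype.card_fin,
      nsmul_eq_mul, mul_one]
    ring
  have count : ∀ (z : Fin n → ℕ) (K : ℕ),
      ∑ k ∈ Finset.range K, ∑ i, (if k < z i then (1 : ℝ) else 0) =
        ((∑ i, min (z i) K : ℕ) : ℝ) := by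
    intro z K
    rw [Finset.sum_comm]
    push_cast
    refine Finset.sum_congr rfl fun i _ => ?_
    rw [← Finset.sum_filter, Finset.sum_const, nsmul_eq_mul, mul_one]
    rw [← Nat.cast_min, Nat.cast_inj, ← Finset.card_range (min (z i) K)]
    congr 1
    ext k
    simp only [Finset.mem_filter, Finset.mem_range]
    omega
  have key := sum_mul_nonneg_of_antitone logIncrement_antitone logIncrement_nonneg N
    (c := fun k => (∑ i, if k < x i then (1 : ℝ) else 0) - ∑ i, if k < y i then (1 : ℝ) else 0)
    (fun K hK => by
      rw [Finset.sum_sub_distrib, count, count, sub_nonneg]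
      exact_mod_cast h K hK)
  simp only [mul_sub, Finset.sum_sub_distrib] at key
  rw [← expand x hxpos hx, ← expand y hypos hy] at key
  have h1 : Real.log ((∏ i, y i : ℕ) : ℝ) ≤ Real.log ((∏ i, x i : ℕ) : ℝ) := by linarith
  have h2 : 0 < ∏ i, y i := Finset.prod_pos fun i _ => hypos i
  have h3 : 0 < ∏ i, x i := Finset.prod_pos fun i _ => hxpos i
  exact_mod_cast (Real.log_le_log_iff (by exact_mod_cast h2) (by exact_mod_cast h3)).1 h1

/-! ### Partial allocations and their completion -/

/-- The value of `S` to agent `i` as a natural number, and `0` if there is no agent `i`. -/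
noncomputable def rank (v : Profile n m) (i : ℕ) (S : Finset (Fin m)) : ℕ :=
  if h : i < n then ⌊v ⟨i, h⟩ S⌋₊ else 0

/-- The items with owner `i`. An owner array encodes a partial allocation; the items with
owner `n` are unassigned. -/
def bundle (m : ℕ) (own : ℕ → ℕ) (i : ℕ) : Finset (Fin m) :=
  Finset.univ.filter fun e => own e = i

@[simp] theorem mem_bundle {own : ℕ → ℕ} {i : ℕ} {e : Fin m} : e ∈ bundle m own i ↔ own e = i := by
  simp [bundle]

variable {v : Profile n m}

theorem isNatRank_rank (hv : ∀ i, IsMatroidRank (v i)) (i : ℕ) : IsNatRank (rank v i) := by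
  unfold rank
  by_cases h : i < n
  · simpa only [h, dif_pos] using (hv ⟨i, h⟩).isNatRank
  · simpa only [h, dif_neg, not_false_iff] using isNatRank_zero

theorem cast_rank (hv : ∀ i, IsMatroidRank (v i)) (i : Fin n) (S : Finset (Fin m)) :
    (rank v i S : ℝ) = v i S := by
  simp [rank, (hv i).natCast_floor]

/-- The dual certificate of the matroid partition theorem, for the ranks truncated at `k`. -/
structure IsCertificate (v : Profile n m) (own : ℕ → ℕ) (k : ℕ) (R : Finset (Fin m)) : Prop where
  unassigned : bundle m own n ⊆ R
  tight : ∀ i < n, min (rank v i R) k = (bundle m own i ∩ R).card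

theorem IsCertificate.sum_min_rank_le (hv : ∀ i, IsMatroidRank (v i)) {own : ℕ → ℕ} {k : ℕ}
    {R : Finset (Fin m)} (hR : IsCertificate v own k R) (hown : ∀ e < m, own e ≤ n)
    {B : Bundles n m} (hB : IsAllocation B) :
    ∑ i : Fin n, min (rank v i (B i)) k ≤ ∑ i : Fin n, (bundle m own i).card := by
  have h1 : ∀ i : Fin n,
      min (rank v i (B i)) k ≤ (bundle m own i ∩ R).card + (B i \ R).card := by
    intro i
    rw [← hR.tight i i.2]
    have hr := isNatRank_rank hv i
    have h2 : rank v i (B i) ≤ rank v i (R ∪ (B i \ R)) := hr.mono fun a ha => by simp [ha]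
    have h3 := hr.union_le R (B i \ R)
    omega
  have h2 : ∑ i : Fin n, (B i \ R).card ≤ ∑ i : Fin n, (bundle m own i \ R).card := by
    rw [← Finset.card_biUnion, ← Finset.card_biUnion]
    · refine Finset.card_le_card fun a ha => ?_
      simp only [Finset.mem_biUnion, Finset.mem_univ, true_and, Finset.mem_sdiff] at ha ⊢
      obtain ⟨-, -, haR⟩ := ha
      have h3 : own a ≠ n := fun hh => haR (hR.unassigned (by simp [hh]))
      exact ⟨⟨own a, lt_of_le_of_ne (hown a a.2) h3⟩, by simp, haR⟩
    · intro i _ j _ hij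
      refine Finset.disjoint_left.2 fun a ha ha' => hij (Fin.ext ?_)
      simp only [Finset.mem_sdiff, mem_bundle] at ha ha'
      rw [← ha.1, ha'.1]
    · intro i _ j _ hij
      exact (hB.disjoint i j hij).mono Finset.sdiff_subset Finset.sdiff_subset
  calc ∑ i : Fin n, min (rank v i (B i)) k
      ≤ ∑ i : Fin n, ((bundle m own i ∩ R).card + (B i \ R).card) :=
        Finset.sum_le_sum fun i _ => h1 i
    _ ≤ ∑ i : Fin n, ((bundle m own i ∩ R).card + (bundle m own i \ R).card) := by
        rw [Finset.sum_add_distrib, Finset.sum_add_distrib]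
        omega
    _ = _ := Finset.sum_congr rfl fun i _ => Finset.card_inter_add_card_sdiff _ _

/-- The owner array after all unassigned items are given to agent `J`. -/
def complete (n : ℕ) (own : ℕ → ℕ) (J e : ℕ) : ℕ :=
  if own e = n then J else own e

theorem bundle_complete_self {own : ℕ → ℕ} {J : ℕ} :
    bundle m (complete n own J) J = bundle m own J ∪ bundle m own n := by
  ext e
  simp only [mem_bundle, complete, Finset.mem_union]
  split_ifs <;> simp_all

theorem bundle_complete_of_ne {own : ℕ → ℕ} {i J : ℕ} (hi : i ≠ n) (hiJ : i ≠ J) :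
    bundle m (complete n own J) i = bundle m own i := by
  ext e
  simp only [mem_bundle, complete]
  split_ifs <;> simp_all
  omega

/-- The unassigned items can all be given to an agent `J` with the largest part of the tight set:
then the rank of the completed bundle for any agent is at most the rank of the original bundle
for `J`. -/
theorem exists_completion (hn : 0 < n) (hv : ∀ i, IsMatroidRank (v i)) {own : ℕ → ℕ}
    {R : Finset (Fin m)} (hR : IsCertificate v own m R)
    (hind : ∀ i < n, rank v i (bundle m own i) = (bundle m own i).card) :
    ∃ J < n, ∀ i < n, rank v i (bundle m (complete n own J) J) ≤
      rank v J (bundle m (complete n own J) J) := by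
  have : Nonempty (Fin n) := ⟨⟨0, hn⟩⟩
  obtain ⟨J, -, hJ⟩ := Finset.exists_max_image Finset.univ
    (fun i : Fin n => (bundle m own i ∩ R).card) Finset.univ_nonempty
  refine ⟨J, J.2, fun i hi => ?_⟩
  have hr := isNatRank_rank hv i
  rw [bundle_complete_self]
  have h1 : rank v J (bundle m own J) ≤ rank v J (bundle m own J ∪ bundle m own n) :=
    (isNatRank_rank hv J).mono Finset.subset_union_left
  have h2 : rank v i (bundle m own J ∪ bundle m own n) ≤ rank v i (R ∪ (bundle m own J \ R)) := by
    refine hr.mono fun a ha => ?_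
    rcases Finset.mem_union.1 ha with ha | ha
    · by_cases haR : a ∈ R <;> simp [haR, mem_bundle.1 ha]
    · simp [hR.unassigned ha]
  have h3 := hr.union_le R (bundle m own J \ R)
  have h4 := hR.tight i hi
  have h5 : rank v i R ≤ m := (hr.le_card R).trans (by simpa using Finset.card_le_univ R)
  have h6 := hJ ⟨i, hi⟩ (Finset.mem_univ _)
  have h7 := Finset.card_inter_add_card_sdiff (bundle m own J) R
  have h8 := hind J J.2
  simp only at h6
  omega

/-- An owner array whose bundles are independent and Lorenz dominating. -/
structure IsDominating (v : Profile n m) (own : ℕ → ℕ) : Prop where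
  own_le : ∀ e < m, own e ≤ n
  indep : ∀ i < n, rank v i (bundle m own i) = (bundle m own i).card
  dominates : ∀ k ≤ m, ∀ B : Bundles n m, IsAllocation B →
    ∑ i : Fin n, min (rank v i (B i)) k ≤ ∑ i : Fin n, min (bundle m own i).card k

/-- A completion of a Lorenz dominating partial allocation, in which nobody values the bundle of
agent `J` more than `J` does, has all the required properties. -/
theorem IsDominating.complete_spec (hv : ∀ i, IsMatroidRank (v i)) {own : ℕ → ℕ}
    (h : IsDominating v own) {J : ℕ} (hJn : J < n)
    (hJ : ∀ i < n, rank v i (bundle m (complete n own J) J) ≤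
      rank v J (bundle m (complete n own J) J)) :
    let A : Bundles n m := fun i => bundle m (complete n own J) i
    IsMaxNSW v A ∧ IsMaxUSW v A ∧ IsEquitableConvertibleEnvyFreeable v A := by
  intro A
  have hA : IsAllocation A := by
    refine ⟨fun e => ?_, fun i j hij => ?_⟩
    · have h1 := h.own_le e e.2
      refine ⟨⟨complete n own J e, ?_⟩, by simp [A]⟩
      unfold complete
      split_ifs <;> omega
    · refine Finset.disjoint_left.2 fun a ha ha' => hij (Fin.ext ?_)
      simp only [A, mem_bundle] at ha ha'
      rw [← ha, ha']
  have hle : ∀ (i : ℕ) (S : Finset (Fin m)), rank v i S ≤ m := fun i S =>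
    ((isNatRank_rank hv i).le_card S).trans (by simpa using Finset.card_le_univ S)
  have hcard : ∀ i : Fin n, (bundle m own i).card ≤ rank v i (A i) := by
    intro i
    rw [← h.indep i i.2]
    refine (isNatRank_rank hv i).mono fun a ha => ?_
    have hi := i.2
    simp only [A, mem_bundle, complete] at ha ⊢
    rw [if_neg (by omega), ha]
  have hdom : ∀ B : Bundles n m, IsAllocation B → ∀ k ≤ m,
      ∑ i : Fin n, min (rank v i (B i)) k ≤ ∑ i : Fin n, min (rank v i (A i)) k := by
    intro B hB k hk
    refine (h.dominates k hk B hB).trans (Finset.sum_le_sum fun i _ => ?_)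
    exact min_le_min_right k (hcard i)
  refine ⟨⟨hA, fun B hB => ?_⟩, ⟨hA, fun B hB => ?_⟩, ?_⟩
  · have h1 := prod_le_prod_of_sum_min_le (fun i => hle i (A i)) (fun i => hle i (B i)) (hdom B hB)
    unfold nsw
    simp_rw [← cast_rank hv]
    refine Real.rpow_le_rpow (by positivity) ?_ (by positivity)
    exact_mod_cast h1
  · have h1 := hdom B hB m le_rfl
    simp only [min_eq_left (hle _ _)] at h1
    unfold usw
    simp_rw [← cast_rank hv]
    exact_mod_cast h1
  · have hown : ∀ i j : Fin n, v i (A j) ≤ v j (A j) := by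
      intro i j
      rw [← cast_rank hv, ← cast_rank hv, Nat.cast_le]
      by_cases hj : (j : ℕ) = J
      · simp only [A, hj]
        exact hJ i i.2
      · simp only [A]
        rw [bundle_complete_of_ne j.2.ne hj, h.indep j j.2]
        exact (isNatRank_rank hv i).le_card _
    -- The payments raise every agent to the common value `m`.
    refine ⟨fun i => m - v i (A i), fun i => ?_, fun i j => by ring, fun i j => ?_⟩
    · change (0 : ℝ) ≤ m - v i (A i)
      rw [← cast_rank hv, sub_nonneg, Nat.cast_le]
      exact hle i _
    · have := hown i j
      linarith

/-! ### The push-relabel step -/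

/-- The state of the partition algorithm for the ranks truncated at `k`: a partial allocation
`own` into independent bundles of at most `k` items, and levels that are valid for each of them. -/
structure IsPhase (v : Profile n m) (k : ℕ) (own lev : ℕ → ℕ) : Prop where
  own_le : ∀ e < m, own e ≤ n
  lev_le : ∀ e < m, lev e ≤ m + 1
  level : ∀ i < n, IsLevel (fun S => min (rank v i S) k) (bundle m own i) fun e => lev e

/-- The bundle of agent `i` after item `e` is added and item `x` is removed. The value `x = m`
stands for no removal. -/
def exchangeBundle (m : ℕ) (own : ℕ → ℕ) (i x e : ℕ) : Finset (Fin m) :=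
  Finset.univ.filter fun y => (own y = i ∧ (y : ℕ) ≠ x) ∨ (y : ℕ) = e

/-- Agent `i` can take the unassigned item `e`, either in addition to its bundle (`x = m`) or in
exchange for an item `x` exactly one level lower. -/
def CanMove (v : Profile n m) (k : ℕ) (own lev : ℕ → ℕ) (e i x : ℕ) : Prop :=
  (rank v i (exchangeBundle m own i x e) = (exchangeBundle m own i x e).card ∧
    (exchangeBundle m own i x e).card ≤ k) ∧ (x = m ∨ own x = i ∧ lev x + 1 = lev e)

theorem exchangeBundle_of_lt {own : ℕ → ℕ} {i e : ℕ} (he : e < m) {x : Fin m} :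
    exchangeBundle m own i x e = insert ⟨e, he⟩ ((bundle m own i).erase x) := by
  ext y
  simp [exchangeBundle, Fin.ext_iff]
  tauto

theorem exchangeBundle_self {own : ℕ → ℕ} {i e : ℕ} (he : e < m) :
    exchangeBundle m own i m e = insert ⟨e, he⟩ (bundle m own i) := by
  ext y
  have hy : (y : ℕ) ≠ m := y.2.ne
  simp [exchangeBundle, Fin.ext_iff, hy]
  tauto

/-- The termination measure: it counts twice the remaining relabelings, plus the levels of the
unassigned items, each increased by one. -/
def potential (n m : ℕ) (own lev : ℕ → ℕ) : ℕ :=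
  ∑ e : Fin m, 2 * (m + 1 - lev e) + ∑ e ∈ bundle m own n, (lev e + 1)

theorem potential_le {own lev : ℕ → ℕ} (h : ∀ e < m, lev e = 0) :
    potential n m own lev ≤ m * (2 * m + 3) := by
  have h1 : ∑ e ∈ bundle m own n, (lev e + 1) ≤ ∑ e : Fin m, (lev e + 1) :=
    Finset.sum_le_sum_of_subset (Finset.subset_univ _)
  have h2 : potential n m own lev ≤ ∑ e : Fin m, (2 * (m + 1 - lev e) + (lev e + 1)) := by
    rw [Finset.sum_add_distrib]
    exact Nat.add_le_add_left h1 _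
  refine h2.trans (le_of_eq ?_)
  have h3 : ∀ e : Fin m, 2 * (m + 1 - lev e) + (lev e + 1) = 2 * m + 3 := fun e => by
    rw [h e e.2]; omega
  simp [h3]

theorem IsPhase.indep (hv : ∀ i, IsMatroidRank (v i)) {k : ℕ} {own lev : ℕ → ℕ}
    (h : IsPhase v k own lev) {i : ℕ} (hi : i < n) :
    rank v i (bundle m own i) = (bundle m own i).card ∧ (bundle m own i).card ≤ k := by
  have h1 := (h.level i hi).indep
  have h2 := (isNatRank_rank hv i).le_card (bundle m own i)
  omega

/-- The bundles after agent `i` takes item `e` and gives up item `x`. -/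
theorem bundle_move {own : ℕ → ℕ} {e i x j : ℕ} (hoe : own e = n) (hi : i < n)
    (hx : x = m ∨ own x = i) (hj : j < n) :
    bundle m (Function.update (Function.update own x n) e i) j =
      if j = i then exchangeBundle m own i x e else bundle m own j := by
  ext y
  have hy := y.2
  split_ifs with hji <;>
  · simp only [mem_bundle, exchangeBundle, Function.update_apply, Finset.mem_filter,
      Finset.mem_univ, true_and]
    rcases hx with hx | hx <;> split_ifs <;> simp_all <;> omega

theorem IsPhase.move (hv : ∀ i, IsMatroidRank (v i)) {k : ℕ} {own lev : ℕ → ℕ}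
    (h : IsPhase v k own lev) {e i x : ℕ} (he : e < m) (hoe : own e = n) (hi : i < n)
    (hxle : x ≤ m) (hc : CanMove v k own lev e i x) :
    IsPhase v k (Function.update (Function.update own x n) e i) lev ∧
    potential n m (Function.update (Function.update own x n) e i) lev < potential n m own lev ∧
    ∀ j < n, (bundle m own j).card ≤
      (bundle m (Function.update (Function.update own x n) e i) j).card := by
  obtain ⟨⟨hrk, hck⟩, hx⟩ := hc
  have hb : ∀ j < n, bundle m (Function.update (Function.update own x n) e i) j =
      if j = i then exchangeBundle m own i x e else bundle m own j :=
    fun j hj => bundle_move hoe hi (hx.imp_right And.left) hj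
  have hr := (isNatRank_rank hv i).truncate k
  have heX : (⟨e, he⟩ : Fin m) ∉ bundle m own i := by simp; omega
  have hmin : min (rank v i (exchangeBundle m own i x e)) k =
      (exchangeBundle m own i x e).card := by omega
  have hpot : potential n m (Function.update (Function.update own x n) e i) lev <
      potential n m own lev := by
    refine Nat.add_lt_add_left ?_ _
    have heU : (⟨e, he⟩ : Fin m) ∈ bundle m own n := by simpa using hoe
    rw [← Finset.add_sum_erase _ _ heU]
    by_cases hxm : x < m
    · have hx' : own x = i ∧ lev x + 1 = lev e := by omega
      have hxe : x ≠ e := by rintro rfl; omega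
      have h1 : bundle m (Function.update (Function.update own x n) e i) n =
          insert ⟨x, hxm⟩ ((bundle m own n).erase ⟨e, he⟩) := by
        ext y
        simp only [mem_bundle, Function.update_apply, Finset.mem_insert, Finset.mem_erase,
          Fin.ext_iff, ne_eq]
        split_ifs <;> simp_all
        omega
      rw [h1, Finset.sum_insert (by simp; omega)]
      simp only
      omega
    · have h1 : bundle m (Function.update (Function.update own x n) e i) n =
          (bundle m own n).erase ⟨e, he⟩ := by
        ext y
        have hy : (y : ℕ) ≠ x := by have := y.2; omega
        simp only [mem_bundle, Function.update_apply, Finset.mem_erase, Fin.ext_iff, ne_eq, hy,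
          if_false]
        split_ifs with hye
        · simp [hye]; omega
        · simp [hye]
      rw [h1]
      simp only
      omega
  have hmain : IsLevel (fun S => min (rank v i S) k) (exchangeBundle m own i x e)
      (fun e => lev e) ∧ (bundle m own i).card ≤ (exchangeBundle m own i x e).card := by
    by_cases hxm : x < m
    · have hx' : own x = i ∧ lev x + 1 = lev e := by omega
      have h1 : exchangeBundle m own i x e = insert ⟨e, he⟩ ((bundle m own i).erase ⟨x, hxm⟩) :=
        exchangeBundle_of_lt he (x := ⟨x, hxm⟩)
      have hxX : (⟨x, hxm⟩ : Fin m) ∈ bundle m own i := by simpa using hx'.1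
      have hcard : (insert (⟨e, he⟩ : Fin m) ((bundle m own i).erase ⟨x, hxm⟩)).card =
          (bundle m own i).card := by
        rw [Finset.card_insert_of_notMem (by simp; omega), Finset.card_erase_add_one hxX]
      rw [h1] at hmin ⊢
      exact ⟨(h.level i hi).swap hr heX hxX hx'.2 (hmin.trans hcard), hcard.ge⟩
    · have h1 : exchangeBundle m own i x e = insert ⟨e, he⟩ (bundle m own i) := by
        rw [show x = m by omega, exchangeBundle_self he]
      rw [h1] at hmin ⊢
      refine ⟨(h.level i hi).of_add hr heX ?_, Finset.card_le_card (Finset.subset_insert _ _)⟩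
      rw [← Finset.card_insert_of_notMem heX, ← hmin]
  refine ⟨⟨fun y hy => ?_, h.lev_le, fun j hj => ?_⟩, hpot, fun j hj => ?_⟩
  · have := h.own_le y hy
    simp only [Function.update_apply]
    split_ifs <;> omega
  · rw [hb j hj]
    split_ifs with hji
    · rw [hji]; exact hmain.1
    · exact h.level j hj
  · rw [hb j hj]
    split_ifs with hji
    · rw [hji]; exact hmain.2
    · exact le_rfl

theorem IsPhase.relabel (hv : ∀ i, IsMatroidRank (v i)) {k : ℕ} {own lev : ℕ → ℕ}
    (h : IsPhase v k own lev) {e : ℕ} (he : e < m) (hoe : own e = n) (hle : lev e ≤ m)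
    (hc : ∀ i < n, ∀ x ≤ m, ¬ CanMove v k own lev e i x) :
    IsPhase v k own (Function.update lev e (lev e + 1)) ∧
    potential n m own (Function.update lev e (lev e + 1)) < potential n m own lev := by
  refine ⟨⟨h.own_le, fun y hy => ?_, fun i hi => ?_⟩, ?_⟩
  · have := h.lev_le y hy
    rw [Function.update_apply]
    split_ifs <;> omega
  · have heX : (⟨e, he⟩ : Fin m) ∉ bundle m own i := by simp; omega
    have h1 : (fun y : Fin m => Function.update lev e (lev e + 1) y) =
        Function.update (fun y : Fin m => lev y) ⟨e, he⟩ (lev e + 1) := by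
      ext y
      simp [Function.update_apply, Fin.ext_iff]
    rw [h1]
    refine (h.level i hi).relabel heX (fun hh => ?_) fun x hx hlx hh => ?_
    · refine hc i hi m le_rfl ⟨?_, Or.inl rfl⟩
      have hcard := Finset.card_insert_of_notMem heX
      have h2 := (isNatRank_rank hv i).le_card (insert ⟨e, he⟩ (bundle m own i))
      rw [exchangeBundle_self he]
      omega
    · refine hc i hi x x.2.le ⟨?_, Or.inr ⟨mem_bundle.1 hx, hlx⟩⟩
      have hcard : (insert (⟨e, he⟩ : Fin m) ((bundle m own i).erase x)).card =
          (bundle m own i).card := by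
        rw [Finset.card_insert_of_notMem (by simp; omega), Finset.card_erase_add_one hx]
      have h2 := (isNatRank_rank hv i).le_card
        (insert (⟨e, he⟩ : Fin m) ((bundle m own i).erase x))
      rw [exchangeBundle_of_lt he]
      omega
  · have heU : (⟨e, he⟩ : Fin m) ∈ bundle m own n := by simpa using hoe
    have h1 : ∀ y : Fin m, y ≠ ⟨e, he⟩ → Function.update lev e (lev e + 1) y = lev y := by
      intro y hy
      exact Function.update_of_ne (fun hh => hy (Fin.ext hh)) _ _
    unfold potential
    rw [← Finset.add_sum_erase _ _ heU, ← Finset.add_sum_erase _ _ heU,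
      ← Finset.add_sum_erase _ _ (Finset.mem_univ (⟨e, he⟩ : Fin m)),
      ← Finset.add_sum_erase _ _ (Finset.mem_univ (⟨e, he⟩ : Fin m)),
      Finset.sum_congr rfl fun y hy => by rw [h1 y (Finset.ne_of_mem_erase hy)],
      Finset.sum_congr (s₁ := (bundle m own n).erase _) rfl fun y hy => by
        rw [h1 y (Finset.ne_of_mem_erase hy)]]
    simp only [Function.update_self]
    omega

/-- At the end of a phase the levels have a gap, and the items above the gap form a
certificate. -/
theorem IsPhase.exists_certificate (hv : ∀ i, IsMatroidRank (v i)) {k : ℕ} {own lev : ℕ → ℕ}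
    (h : IsPhase v k own lev) (hend : ∀ e < m, own e = n → m < lev e) :
    ∃ R, IsCertificate v own k R := by
  obtain ⟨g, hg, hgap⟩ : ∃ g ∈ Finset.range (m + 1),
      g ∉ Finset.univ.image fun e : Fin m => lev e := by
    refine Finset.exists_mem_notMem_of_card_lt_card ?_
    refine Finset.card_image_le.trans_lt ?_
    simp
  simp only [Finset.mem_range, Finset.mem_image, Finset.mem_univ, true_and, not_exists] at hg hgap
  refine ⟨Finset.univ.filter fun e => g < lev e, fun e he => ?_, fun i hi => ?_⟩
  · have := hend e e.2 (mem_bundle.1 he)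
    simp only [Finset.mem_filter, Finset.mem_univ, true_and]
    omega
  · have h1 := (h.level i hi).rank_above_gap ((isNatRank_rank hv i).truncate k) hgap
    rw [h1]
    congr 1
    ext e
    simp

/-! ### Verification of programs -/

@[simp] theorem Memory.setReg_reg (s : Memory) (x k y : ℕ) :
    (s.setReg x k).reg y = if y = x then k else s.reg y := by
  simp [Memory.setReg, Function.update_apply]

@[simp] theorem Memory.setReg_arr (s : Memory) (x k : ℕ) : (s.setReg x k).arr = s.arr := rfl

@[simp] theorem Memory.setArr_reg (s : Memory) (a i k : ℕ) : (s.setArr a i k).reg = s.reg := rfl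

@[simp] theorem Memory.setArr_arr (s : Memory) (a i k b : ℕ) :
    (s.setArr a i k).arr b = if b = a then Function.update (s.arr a) i k else s.arr b := by
  simp [Memory.setArr, Function.update_apply]

/-- Whether a program contains an instruction that writes to register `y`. -/
def Prog.writesReg : Prog → ℕ → Bool
  | .skip, _ => false
  | .assign x _, y => decide (y = x)
  | .write _ _ _, _ => false
  | .query x _ _, y => decide (y = x)
  | .seq c₁ c₂, y => c₁.writesReg y || c₂.writesReg y
  | .branch _ c₁ c₂, y => c₁.writesReg y || c₂.writesReg y
  | .loop _ c, y => c.writesReg y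

/-- Whether a program contains an instruction that writes to array `a`. -/
def Prog.writesArr : Prog → ℕ → Bool
  | .skip, _ => false
  | .assign _ _, _ => false
  | .write b _ _, a => decide (a = b)
  | .query _ _ _, _ => false
  | .seq c₁ c₂, a => c₁.writesArr a || c₂.writesArr a
  | .branch _ c₁ c₂, a => c₁.writesArr a || c₂.writesArr a
  | .loop _ c, a => c.writesArr a

/-- The memories `s` and `t` agree on everything to which the program `c` never writes. -/
structure Frame (c : Prog) (s t : Memory) : Prop where
  reg : ∀ y, c.writesReg y = false → t.reg y = s.reg y
  arr : ∀ a, c.writesArr a = false → t.arr a = s.arr a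

theorem Frame.refl (c : Prog) (s : Memory) : Frame c s s := ⟨fun _ _ => rfl, fun _ _ => rfl⟩

theorem Frame.trans {c : Prog} {s t u : Memory} (h : Frame c s t) (h' : Frame c t u) :
    Frame c s u :=
  ⟨fun y hy => (h'.reg y hy).trans (h.reg y hy), fun a ha => (h'.arr a ha).trans (h.arr a ha)⟩

theorem Frame.mono {c d : Prog} {s t : Memory} (h : Frame c s t)
    (hr : ∀ y, d.writesReg y = false → c.writesReg y = false)
    (ha : ∀ a, d.writesArr a = false → c.writesArr a = false) : Frame d s t :=
  ⟨fun y hy => h.reg y (hr y hy), fun a h' => h.arr a (ha a h')⟩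

theorem Exec.frame {O : ℕ → (ℕ → ℕ) → ℕ} {c : Prog} {s t : Memory} {k : ℕ}
    (h : Exec O c s t k) : Frame c s t := by
  induction h with
  | skip => exact .refl _ _
  | assign s x e => exact ⟨fun y hy => by simp_all [Prog.writesReg], fun _ _ => rfl⟩
  | write s b i e =>
    exact ⟨fun _ _ => rfl, fun a ha => by simp_all [Prog.writesArr]⟩
  | query s x i a => exact ⟨fun y hy => by simp_all [Prog.writesReg], fun _ _ => rfl⟩
  | seq _ _ ih₁ ih₂ =>
    exact (ih₁.mono (fun y hy => by simp_all [Prog.writesReg])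
      fun y hy => by simp_all [Prog.writesArr]).trans
      (ih₂.mono (fun y hy => by simp_all [Prog.writesReg])
        fun y hy => by simp_all [Prog.writesArr])
  | branch_true _ _ ih | branch_false _ _ ih =>
    exact ih.mono (fun y hy => by simp_all [Prog.writesReg])
      fun y hy => by simp_all [Prog.writesArr]
  | loop_done => exact .refl _ _
  | loop_step _ _ _ ih₁ ih₂ =>
    exact Frame.trans (c := .loop _ _) (ih₁.mono (fun _ hy => hy) fun _ ha => ha) ih₂

/-- Total correctness with a time bound: `c` started in `s` halts after at most `B` steps in a
memory that satisfies `Q`. -/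
def Runs (O : ℕ → (ℕ → ℕ) → ℕ) (c : Prog) (s : Memory) (B : ℕ) (Q : Memory → Prop) : Prop :=
  ∃ t k, Exec O c s t k ∧ k ≤ B ∧ Q t

section Rules

variable {O : ℕ → (ℕ → ℕ) → ℕ} {c c₁ c₂ : Prog} {s : Memory} {B B₁ B₂ : ℕ}
  {Q Q' : Memory → Prop}

theorem Runs.mono (h : Runs O c s B₁ Q') (hB : B₁ ≤ B) (hQ : ∀ t, Frame c s t → Q' t → Q t) :
    Runs O c s B Q := by
  obtain ⟨t, k, he, hk, hq⟩ := h
  exact ⟨t, k, he, hk.trans hB, hQ t he.frame hq⟩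

theorem Runs.skip (h : Q s) : Runs O .skip s 1 Q := ⟨_, _, .skip s, le_rfl, h⟩

theorem Runs.assign {x : ℕ} {e : Expr} (h : Q (s.setReg x (e.eval s))) :
    Runs O (.assign x e) s (e.cost + 1) Q := ⟨_, _, .assign s x e, le_rfl, h⟩

theorem Runs.write {a : ℕ} {i e : Expr} (h : Q (s.setArr a (i.eval s) (e.eval s))) :
    Runs O (.write a i e) s (i.cost + e.cost + 1) Q := ⟨_, _, .write s a i e, le_rfl, h⟩

theorem Runs.query {x a : ℕ} {i : Expr} (h : Q (s.setReg x (O (i.eval s) (s.arr a)))) :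
    Runs O (.query x i a) s (i.cost + 1) Q := ⟨_, _, .query s x i a, le_rfl, h⟩

theorem Runs.seq (h : Runs O c₁ s B₁ fun t => Frame c₁ s t → Runs O c₂ t B₂ Q) :
    Runs O (.seq c₁ c₂) s (B₁ + B₂) Q := by
  obtain ⟨t, k, he, hk, u, l, he', hl, hq⟩ := h.mono le_rfl fun t hf ht => ht hf
  exact ⟨u, _, .seq he he', Nat.add_le_add hk hl, hq⟩

theorem Runs.branch {b : Expr} (h₁ : b.eval s ≠ 0 → Runs O c₁ s B₁ Q)
    (h₂ : b.eval s = 0 → Runs O c₂ s B₂ Q) :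
    Runs O (.branch b c₁ c₂) s (b.cost + (B₁ + B₂) + 1) Q := by
  by_cases hb : b.eval s = 0
  · obtain ⟨t, k, he, hk, hq⟩ := h₂ hb
    exact ⟨t, _, .branch_false hb he, by omega, hq⟩
  · obtain ⟨t, k, he, hk, hq⟩ := h₁ hb
    exact ⟨t, _, .branch_true hb he, by omega, hq⟩

/-- The rule for loops with an invariant `I` and a decreasing measure `μ`. -/
theorem Runs.loop {b : Expr} (I : Memory → Prop) (μ : Memory → ℕ) (h0 : I s)
    (hstep : ∀ t, Frame c s t → I t → b.eval t ≠ 0 →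
      Runs O c t B fun u => I u ∧ μ u < μ t) :
    Runs O (.loop b c) s (μ s * (b.cost + B + 1) + (b.cost + 1))
      fun t => I t ∧ b.eval t = 0 := by
  suffices H : ∀ N t, Frame c s t → I t → μ t ≤ N →
      Runs O (.loop b c) t (μ t * (b.cost + B + 1) + (b.cost + 1)) fun t => I t ∧ b.eval t = 0 from
    H (μ s) s (.refl _ _) h0 le_rfl
  intro N
  induction N with
  | zero =>
    intro t hf ht hμ
    by_cases hb : b.eval t = 0
    · exact ⟨t, _, .loop_done hb, by omega, ht, hb⟩
    · obtain ⟨u, k, -, -, -, h⟩ := hstep t hf ht hb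
      omega
  | succ N ih =>
    intro t hf ht hμ
    by_cases hb : b.eval t = 0
    · exact ⟨t, _, .loop_done hb, by omega, ht, hb⟩
    · obtain ⟨u, k, he, hk, hu, hlt⟩ := hstep t hf ht hb
      obtain ⟨w, l, he', hl, hw⟩ := ih u (hf.trans he.frame) hu (by omega)
      refine ⟨w, _, .loop_step hb he he', ?_, hw⟩
      have h1 : (μ u + 1) * (b.cost + B + 1) ≤ μ t * (b.cost + B + 1) :=
        Nat.mul_le_mul_right _ hlt
      rw [Nat.add_mul, Nat.one_mul] at h1
      omega

/-- The loop in which register `x` runs through the numbers below `bound`. -/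
def forLoop (x : ℕ) (bound : Expr) (c : Prog) : Prog :=
  .seq (.assign x (.const 0))
    (.loop (.lt (.reg x) bound) (.seq c (.assign x (.add (.reg x) (.const 1)))))

/-- The time bound for a `forLoop` with `N` rounds, when the evaluation of the loop bound takes
`b` steps and the body at most `B` steps. -/
def forCost (b B N : ℕ) : ℕ := N * (b + B + 7) + (b + 5)

theorem Runs.forLoop {x N : ℕ} {bound : Expr} (I : ℕ → Memory → Prop)
    (hx : c.writesReg x = false)
    (hN : ∀ t, Frame (forLoop x bound c) s t → bound.eval t = N)
    (h0 : I 0 (s.setReg x 0))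
    (hstep : ∀ j < N, ∀ t, Frame (FairDivision.forLoop x bound c) s t → t.reg x = j → I j t →
      Runs O c t B fun u => I (j + 1) (u.setReg x (j + 1))) :
    Runs O (FairDivision.forLoop x bound c) s (forCost bound.cost B N) (I N) := by
  have hs : Frame (FairDivision.forLoop x bound c) s (s.setReg x 0) :=
    ⟨fun y hy => by simp_all [FairDivision.forLoop, Prog.writesReg], fun a _ => rfl⟩
  refine Runs.mono (.seq (.assign fun _ => .loop (B := B + 4)
    (fun t => t.reg x ≤ N ∧ I (t.reg x) t) (fun t => N - t.reg x) ?_ ?_)) ?_ ?_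
  · simpa [Expr.eval] using h0
  · intro t hf ht hb
    have hf' : Frame (FairDivision.forLoop x bound c) s t :=
      hs.trans (hf.mono (fun y hy => by simp_all [FairDivision.forLoop, Prog.writesReg])
        fun a ha => by simp_all [FairDivision.forLoop, Prog.writesArr])
    have hlt : t.reg x < N := by
      rw [← hN t hf']
      by_contra hge
      exact hb (by simp [Expr.eval, hge])
    refine .seq ((hstep _ hlt t hf' rfl ht.2).mono le_rfl fun u hu hI _ => .assign ?_)
    have hux : u.reg x = t.reg x := hu.reg x hx
    simp only [Expr.eval, hux, Memory.setReg_reg, if_true]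
    exact ⟨⟨by omega, hI⟩, by omega⟩
  · simp [forCost, Expr.cost, Expr.eval]
    ring_nf
    omega
  · intro t hf ht
    have hge : ¬ t.reg x < N := by
      rw [← hN t hf]
      intro hlt
      simpa [Expr.eval, hlt] using ht.2
    have : t.reg x = N := by omega
    rw [← this]
    exact ht.1.2

end Rules

/-- Conjunction of conditions. -/
def Expr.and (e₁ e₂ : Expr) : Expr :=
  .eq (.add (.lt (.const 0) e₁) (.lt (.const 0) e₂)) (.const 2)

theorem Expr.eval_and (s : Memory) (e₁ e₂ : Expr) :
    (e₁.and e₂).eval s = if e₁.eval s ≠ 0 ∧ e₂.eval s ≠ 0 then 1 else 0 := by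
  simp only [Expr.and, Expr.eval]
  by_cases h₁ : e₁.eval s = 0 <;> by_cases h₂ : e₂.eval s = 0 <;>
    simp [h₁, h₂, Nat.pos_iff_ne_zero]

theorem Expr.eval_and_ne_zero {s : Memory} {e₁ e₂ : Expr} :
    (e₁.and e₂).eval s ≠ 0 ↔ e₁.eval s ≠ 0 ∧ e₂.eval s ≠ 0 := by
  rw [Expr.eval_and]
  split_ifs with h <;> simp [h]

theorem Expr.eval_eq_ne_zero {s : Memory} {e₁ e₂ : Expr} :
    (Expr.eq e₁ e₂).eval s ≠ 0 ↔ e₁.eval s = e₂.eval s := by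
  simp [Expr.eval]

theorem Expr.eval_lt_ne_zero {s : Memory} {e₁ e₂ : Expr} :
    (Expr.lt e₁ e₂).eval s ≠ 0 ↔ e₁.eval s < e₂.eval s := by
  simp [Expr.eval]

theorem Expr.eval_add_ne_zero {s : Memory} {e₁ e₂ : Expr} :
    (Expr.add e₁ e₂).eval s ≠ 0 ↔ e₁.eval s ≠ 0 ∨ e₂.eval s ≠ 0 := by
  simp only [Expr.eval]
  omega

/-! ### The algorithm -/

/-!
Array `0` holds the owners, array `1` the levels, and array `2` the indicator of the bundle of
the next query. Registers `0` to `2` hold the numbers of agents and items and the truncation `k`.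
Register `3` is the current item of the push-relabel phases, and afterwards the agent who receives
the unassigned items. Registers `4` to `6` are loop variables. The functions `fillCost`,
`testCost` and so on are bounds for the running times of the programs with these names.
-/

/-- Store the values of the expression `b`, evaluated with register `6` running through the items,
in array `2`, and their sum in register `7`. -/
def fill (b : Expr) : Prog :=
  .seq (.assign 7 (.const 0))
    (forLoop 6 (.reg 1)
      (.seq (.write 2 (.reg 6) b) (.assign 7 (.add (.reg 7) b))))

def fillCost (b m : ℕ) : ℕ := 2 + forCost 1 ((1 + b + 1) + (1 + b + 1 + 1)) m

theorem fill_runs {O : ℕ → (ℕ → ℕ) → ℕ} {b : Expr} {s : Memory} {f : ℕ → ℕ} (hm : s.reg 1 = m)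
    (hb : ∀ t, Frame (fill b) s t → b.eval t = f (t.reg 6)) :
    Runs O (fill b) s (fillCost b.cost m) fun t =>
      (∀ y < m, t.arr 2 y = f y) ∧ t.reg 7 = ∑ y ∈ Finset.range m, f y := by
  refine .mono (.seq (.assign fun hf => .forLoop (N := m)
    (fun j t => (∀ y < j, t.arr 2 y = f y) ∧ t.reg 7 = ∑ y ∈ Finset.range j, f y)
    rfl ?_ ?_ ?_)) le_rfl fun t _ ht => ht
  · intro t ht
    simpa [Expr.eval, hm] using ht.reg 1 rfl
  · simp [Expr.eval]
  · intro j hj t ht hx hI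
    have hF : Frame (fill b) s t := .trans (hf.mono
      (fun y hy => by simp_all [fill, forLoop, Prog.writesReg]) fun _ _ => rfl)
      (ht.mono (fun y hy => by simp_all [fill, forLoop, Prog.writesReg])
        fun a ha => by simp_all [fill, forLoop, Prog.writesArr])
    refine .seq (.write fun hf' => .assign ?_)
    have h1 := hb t hF
    have h2 := hb _ (hF.trans (hf'.mono
      (fun y hy => by simp [Prog.writesReg])
      fun a ha => by simp_all [fill, forLoop, Prog.writesArr]))
    simp only [Expr.eval, Memory.setArr_reg, hx, h1] at h2
    simp only [Expr.eval, Memory.setReg_arr, Memory.setArr_arr, Memory.setReg_reg,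
      Memory.setArr_reg, hx, h1, h2, hI.2, if_true, Finset.sum_range_succ]
    refine ⟨fun y hy => ?_, by simp⟩
    rw [Function.update_apply]
    split_ifs with hyj
    · rw [hyj]
    · exact hI.1 y (by omega)

/-- The indicator of the bundle of agent `reg 4` after it takes item `reg 3` and gives up item
`reg 5`. -/
def moveIndicator : Expr :=
  .add (.and (.eq (.read 0 (.reg 6)) (.reg 4)) (.lt (.eq (.reg 6) (.reg 5)) (.const 1)))
    (.eq (.reg 6) (.reg 3))

/-- The condition for a move, when register `7` holds the number of items of the new bundle and
register `8` its value. -/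
def moveCondition : Expr :=
  .and (.and (.eq (.reg 8) (.reg 7)) (.lt (.reg 7) (.add (.reg 2) (.const 1))))
    (.add (.eq (.reg 5) (.reg 1))
      (.and (.eq (.read 0 (.reg 5)) (.reg 4))
        (.eq (.add (.read 1 (.reg 5)) (.const 1)) (.read 1 (.reg 3)))))

/-- Record the agent `reg 4` and the item `reg 5` in registers `9` and `10` if the agent can
take item `reg 3` in exchange for item `reg 5`. -/
def test : Prog :=
  .seq (fill moveIndicator) (.seq (.query 8 (.reg 4) 2)
    (.branch moveCondition (.seq (.assign 9 (.reg 4)) (.assign 10 (.reg 5))) .skip))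

def testCost (m : ℕ) : ℕ := fillCost moveIndicator.cost m + 60

theorem valueOracle_eq_rank (i : ℕ) (f : ℕ → ℕ) :
    valueOracle v i f = rank v i (Finset.univ.filter fun e : Fin m => f e ≠ 0) := rfl

theorem card_exchangeBundle (own : ℕ → ℕ) (i x e : ℕ) :
    (exchangeBundle m own i x e).card =
      ∑ y ∈ Finset.range m, if (own y = i ∧ y ≠ x) ∨ y = e then 1 else 0 := by
  rw [Finset.sum_range, exchangeBundle, Finset.card_filter]

theorem moveCondition_eval {t : Memory} (hm : t.reg 1 = m)
    (h7 : t.reg 7 = (exchangeBundle m (t.arr 0) (t.reg 4) (t.reg 5) (t.reg 3)).card)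
    (h8 : t.reg 8 = rank v (t.reg 4)
      (exchangeBundle m (t.arr 0) (t.reg 4) (t.reg 5) (t.reg 3))) :
    moveCondition.eval t ≠ 0 ↔
      CanMove v (t.reg 2) (t.arr 0) (t.arr 1) (t.reg 3) (t.reg 4) (t.reg 5) := by
  simp only [moveCondition, Expr.eval_and_ne_zero, Expr.eval_eq_ne_zero, Expr.eval_lt_ne_zero,
    Expr.eval_add_ne_zero]
  simp only [Expr.eval, CanMove, ← h7, ← h8, hm, Nat.lt_succ_iff]

theorem test_runs {s : Memory} (hm : s.reg 1 = m) (hown : s.arr 0 (s.reg 3) ≠ s.reg 4) :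
    Runs (valueOracle v) test s (testCost m) fun t =>
      (CanMove v (s.reg 2) (s.arr 0) (s.arr 1) (s.reg 3) (s.reg 4) (s.reg 5) ∧
        t.reg 9 = s.reg 4 ∧ t.reg 10 = s.reg 5) ∨
      (¬ CanMove v (s.reg 2) (s.arr 0) (s.arr 1) (s.reg 3) (s.reg 4) (s.reg 5) ∧
        t.reg 9 = s.reg 9 ∧ t.reg 10 = s.reg 10) := by
  have hfill := fill_runs (O := valueOracle v) (m := m) (s := s) (b := moveIndicator)
    (f := fun y => if (s.arr 0 y = s.reg 4 ∧ y ≠ s.reg 5) ∨ y = s.reg 3 then 1 else 0) hm (by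
      intro t ht
      simp only [moveIndicator, Expr.eval, Expr.eval_and, ht.reg 3 rfl, ht.reg 4 rfl,
        ht.reg 5 rfl, ht.arr 0 rfl]
      by_cases h1 : t.reg 6 = s.reg 3
      · simp [h1, hown]
      · by_cases h2 : t.reg 6 = s.reg 5 <;> by_cases h3 : s.arr 0 (t.reg 6) = s.reg 4 <;>
          simp [h1, h2, h3])
  refine .mono (.seq (hfill.mono le_rfl fun t hf ht _ =>
    .seq (B₁ := 2) (B₂ := 58) (.query fun _ => ?_))) le_rfl fun t _ ht => ht
  have hset : (Finset.univ.filter fun e : Fin m => t.arr 2 e ≠ 0) =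
      exchangeBundle m (s.arr 0) (s.reg 4) (s.reg 5) (s.reg 3) := by
    ext y
    simp only [exchangeBundle, Finset.mem_filter, Finset.mem_univ, true_and, ht.1 y y.2]
    split_ifs with h <;> simp [h]
  have h4 := hf.reg 4 rfl
  have hc := moveCondition_eval (v := v)
    (t := t.setReg 8 (valueOracle v ((Expr.reg 4).eval t) (t.arr 2)))
    (by simpa using (hf.reg 1 rfl).trans hm)
    (by simpa [hf.reg 3 rfl, hf.reg 4 rfl, hf.reg 5 rfl, hf.arr 0 rfl, card_exchangeBundle]
        using ht.2)
    (by simp [hf.reg 3 rfl, hf.reg 4 rfl, hf.reg 5 rfl, hf.arr 0 rfl, valueOracle_eq_rank,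
          Expr.eval, hset])
  simp only [Memory.setReg_reg, Memory.setReg_arr, hf.reg 2 rfl, hf.reg 3 rfl, hf.reg 4 rfl,
    hf.reg 5 rfl, hf.arr 0 rfl, hf.arr 1 rfl, Nat.reduceEqDiff, if_false] at hc
  refine .mono (.branch (Q := _) (fun hb => .seq (.assign fun _ => .assign (.inl ?_)))
    fun hb => .skip (.inr ?_)) (by decide) fun t _ ht => ht
  · exact ⟨hc.1 hb, by simp [Expr.eval, hf.reg 4 rfl, hf.reg 5 rfl]⟩
  · exact ⟨fun h => hc.2 h hb, by simp [hf.reg 9 rfl, hf.reg 10 rfl]⟩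

/-- Search for an agent (register `9`) and an item (register `10`) which allow a move with the
unassigned item `reg 3`. Register `9` holds the number of agents if there are none. -/
def search : Prog :=
  .seq (.assign 9 (.reg 0))
    (forLoop 4 (.reg 0) (forLoop 5 (.add (.reg 1) (.const 1)) test))

def searchCost (n m : ℕ) : ℕ := 2 + forCost 1 (forCost 3 (testCost m) (m + 1)) n

theorem search_runs {s : Memory} (hn : s.reg 0 = n) (hm : s.reg 1 = m)
    (hown : s.arr 0 (s.reg 3) = n) :
    Runs (valueOracle v) search s (searchCost n m) fun t =>
      (t.reg 9 < n ∧ t.reg 10 ≤ m ∧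
        CanMove v (s.reg 2) (s.arr 0) (s.arr 1) (s.reg 3) (t.reg 9) (t.reg 10)) ∨
      (t.reg 9 = n ∧
        ∀ i < n, ∀ x ≤ m, ¬ CanMove v (s.reg 2) (s.arr 0) (s.arr 1) (s.reg 3) i x) := by
  -- The searched pairs so far are those before the position `(j, l)` of the two loops.
  let I : ℕ → ℕ → Memory → Prop := fun j l t =>
    (t.reg 9 < n ∧ t.reg 10 ≤ m ∧
      CanMove v (s.reg 2) (s.arr 0) (s.arr 1) (s.reg 3) (t.reg 9) (t.reg 10)) ∨
    (t.reg 9 = n ∧ ∀ i x, (i < j ∧ x ≤ m) ∨ (i = j ∧ x < l) →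
      ¬ CanMove v (s.reg 2) (s.arr 0) (s.arr 1) (s.reg 3) i x)
  refine .mono (.seq (.assign fun hf => .forLoop (N := n) (fun j => I j 0) rfl ?_ ?_ ?_)) le_rfl
    fun t _ ht => ht.imp_right fun h => ⟨h.1, fun i hi x hx => h.2 i x (.inl ⟨hi, hx⟩)⟩
  · intro t ht
    simpa [Expr.eval, hn] using ht.reg 0 rfl
  · exact .inr ⟨by simp [Expr.eval, hn], fun i x h => by omega⟩
  · intro j hj t ht htj hI
    refine .mono (.forLoop (N := m + 1) (I j) rfl ?_ hI ?_) le_rfl fun u hu hIu => ?_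
    · intro u hu
      simp [Expr.eval, hu.reg 1 rfl, ht.reg 1 rfl, hm]
    · intro l hl u hu hul hIu
      have h2 : u.reg 2 = s.reg 2 := by simp [hu.reg 2 rfl, ht.reg 2 rfl]
      have h3 : u.reg 3 = s.reg 3 := by simp [hu.reg 3 rfl, ht.reg 3 rfl]
      have h4 : u.reg 4 = j := by rw [hu.reg 4 rfl, htj]
      have ha0 : u.arr 0 = s.arr 0 := by rw [hu.arr 0 rfl, ht.arr 0 rfl]; rfl
      have ha1 : u.arr 1 = s.arr 1 := by rw [hu.arr 1 rfl, ht.arr 1 rfl]; rfl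
      refine (test_runs (v := v) (m := m) (by simp [hu.reg 1 rfl, ht.reg 1 rfl, hm])
        (by rw [h3, h4, ha0, hown]; omega)).mono le_rfl fun w _ hw => ?_
      rw [h2, h3, h4, ha0, ha1, hul] at hw
      rcases hw with ⟨hc, h9, h10⟩ | ⟨hc, h9, h10⟩
      · refine .inl ?_
        simp only [Memory.setReg_reg, Nat.reduceEqDiff, if_false, h9, h10]
        exact ⟨hj, by omega, hc⟩
      · simp only [I, Memory.setReg_reg, Nat.reduceEqDiff, if_false, h9, h10]
        refine hIu.imp_right fun h => ⟨h.1, fun i x hix => ?_⟩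
        by_cases hx : i = j ∧ x = l
        · rw [hx.1, hx.2]; exact hc
        · exact h.2 i x (by omega)
    · simp only [I, Memory.setReg_reg, Nat.reduceEqDiff, if_false]
      exact hIu.imp_right fun h => ⟨h.1, fun i x hix => h.2 i x (by omega)⟩

/-- One push-relabel step for the unassigned item `reg 3`. If the search returns `reg 10 = m`,
then the first write is outside of the range of the items and has no effect. -/
def step : Prog :=
  .seq search (.seq
    (.branch (.lt (.reg 9) (.reg 0))
      (.seq (.write 0 (.reg 10) (.reg 0)) (.write 0 (.reg 3) (.reg 9)))
      (.write 1 (.reg 3) (.add (.read 1 (.reg 3)) (.const 1))))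
    (.assign 3 (.const 0)))

theorem step_runs (hv : ∀ i, IsMatroidRank (v i)) {s : Memory} (hn : s.reg 0 = n)
    (hm : s.reg 1 = m) (h : IsPhase v (s.reg 2) (s.arr 0) (s.arr 1)) (he : s.reg 3 < m)
    (hown : s.arr 0 (s.reg 3) = n) (hlev : s.arr 1 (s.reg 3) ≤ m) :
    Runs (valueOracle v) step s (searchCost n m + 30) fun t =>
      t.reg 3 = 0 ∧ IsPhase v (s.reg 2) (t.arr 0) (t.arr 1) ∧
      potential n m (t.arr 0) (t.arr 1) < potential n m (s.arr 0) (s.arr 1) ∧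
      ∀ i < n, (bundle m (s.arr 0) i).card ≤ (bundle m (t.arr 0) i).card := by
  refine .mono (.seq ((search_runs (v := v) hn hm hown).mono le_rfl fun t hf ht _ =>
    .seq (B₁ := 26) (B₂ := 2) ?_)) (by omega) fun t _ ht => ht
  have h0 : t.reg 0 = n := by rw [hf.reg 0 rfl, hn]
  have h3 : t.reg 3 = s.reg 3 := hf.reg 3 rfl
  have ha0 : t.arr 0 = s.arr 0 := hf.arr 0 rfl
  have ha1 : t.arr 1 = s.arr 1 := hf.arr 1 rfl
  refine .mono (.branch (Q := _) (fun hb => .seq (.write fun _ => .write fun _ => .assign ?_))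
    fun hb => .write fun _ => .assign ?_) (by decide) fun t _ ht => ht
  · have hc := ht.resolve_right fun hh => hb (by simp [Expr.eval, hh.1, h0])
    have := h.move hv he hown hc.1 hc.2.1 hc.2.2
    simpa [Expr.eval, h0, h3, ha0, ha1] using this
  · have hc := ht.resolve_left fun hh => by simp [Expr.eval, hh.1, h0] at hb
    have := h.relabel hv he hown hlev hc.2
    simpa [Expr.eval, h0, h3, ha0, ha1] using this

/-- Pass over the items that are assigned or above level `m`, return to the first item after every
step, and stop when there is no item left for a step. -/
def phaseLoop : Prog :=
  .loop (.lt (.reg 3) (.reg 1))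
    (.branch (.and (.eq (.read 0 (.reg 3)) (.reg 0))
        (.lt (.read 1 (.reg 3)) (.add (.reg 1) (.const 1))))
      step (.assign 3 (.add (.reg 3) (.const 1))))

/-- The phase for the ranks truncated at `k`. All levels start at zero. -/
def phase : Prog :=
  .seq (forLoop 6 (.reg 1) (.write 1 (.reg 6) (.const 0))) (.seq (.assign 3 (.const 0)) phaseLoop)

def phaseCost (n m : ℕ) : ℕ :=
  forCost 1 3 m + (2 + ((m * (2 * m + 3) * (m + 1) + m) * (searchCost n m + 60) + 4))

theorem phase_runs (hv : ∀ i, IsMatroidRank (v i)) {s : Memory} (hn : s.reg 0 = n)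
    (hm : s.reg 1 = m) (hown : ∀ e < m, s.arr 0 e ≤ n)
    (hind : ∀ i < n, rank v i (bundle m (s.arr 0) i) = (bundle m (s.arr 0) i).card ∧
      (bundle m (s.arr 0) i).card ≤ s.reg 2) :
    Runs (valueOracle v) phase s (phaseCost n m) fun t =>
      IsPhase v (s.reg 2) (t.arr 0) (t.arr 1) ∧ (∀ e < m, t.arr 0 e = n → m < t.arr 1 e) ∧
      ∀ i < n, (bundle m (s.arr 0) i).card ≤ (bundle m (t.arr 0) i).card := by
  refine .mono (.seq (.mono (.forLoop (N := m) (B := 3)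
    (fun j t => ∀ e < j, t.arr 1 e = 0) rfl ?_ ?_ ?_) le_rfl fun t hf ht _ =>
      .seq (.assign fun _ => .mono (.loop (B := searchCost n m + 55)
        (fun t => IsPhase v (s.reg 2) (t.arr 0) (t.arr 1) ∧
          (∀ i < n, (bundle m (s.arr 0) i).card ≤ (bundle m (t.arr 0) i).card) ∧
          ∀ e < t.reg 3, e < m → t.arr 0 e = n → m < t.arr 1 e)
        (fun t => potential n m (t.arr 0) (t.arr 1) * (m + 1) + (m - t.reg 3)) ?_ ?_)
        (B := (m * (2 * m + 3) * (m + 1) + m) * (searchCost n m + 60) + 4)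
        ?_ fun u hfu hu => ?_))) le_rfl fun t _ ht => ht
  · intro t ht
    simpa [Expr.eval, hm] using ht.reg 1 rfl
  · simp
  · intro j hj t ht htj hI
    refine .write ?_
    intro e he
    simp only [Expr.eval, Memory.setReg_arr, Memory.setArr_arr, if_true, htj,
      Function.update_apply]
    split_ifs with hej
    · rfl
    · exact hI e (by omega)
  · have ha0 : t.arr 0 = s.arr 0 := hf.arr 0 rfl
    simp only [Memory.setReg_arr, Memory.setReg_reg, Expr.eval, if_true, ha0]
    refine ⟨⟨hown, fun e he => by rw [ht e he]; omega, fun i hi => ?_⟩, fun i _ => le_rfl,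
      fun e he => by omega⟩
    have hz : (fun e : Fin m => t.arr 1 e) = fun _ => 0 := funext fun e => ht e e.2
    rw [hz]
    apply isLevel_zero
    have := hind i hi
    omega
  · intro u hfu hu hb
    have hu0 : u.reg 0 = n := by rw [hfu.reg 0 rfl]; simpa [hn] using hf.reg 0 rfl
    have hu1 : u.reg 1 = m := by rw [hfu.reg 1 rfl]; simpa [hm] using hf.reg 1 rfl
    have hu2 : u.reg 2 = s.reg 2 := by rw [hfu.reg 2 rfl]; simpa using hf.reg 2 rfl
    have hu3 : u.reg 3 < m := by
      rw [← hu1]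
      exact Expr.eval_lt_ne_zero.1 hb
    obtain ⟨hph, hsize, hpass⟩ := hu
    refine .mono (.branch (B₁ := searchCost n m + 30) (Q := _) (fun hc => ?_)
      fun hc => .assign ?_) ?_ fun t _ ht => ht
    · simp only [Expr.eval_and_ne_zero, Expr.eval_eq_ne_zero, Expr.eval_lt_ne_zero] at hc
      simp only [Expr.eval, hu0, hu1] at hc
      refine (step_runs hv hu0 hu1 (hu2 ▸ hph) hu3 hc.1 (by omega)).mono le_rfl
        fun w _ ⟨h3, hw, hpot, hw'⟩ => ⟨⟨hu2 ▸ hw, fun i hi => (hsize i hi).trans (hw' i hi),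
          fun e he => by omega⟩, ?_⟩
      -- The position drops to `0`, but the potential decreases.
      have := Nat.mul_le_mul_right (m + 1) hpot
      rw [Nat.succ_mul] at this
      change potential n m (w.arr 0) (w.arr 1) * (m + 1) + (m - w.reg 3) <
        potential n m (u.arr 0) (u.arr 1) * (m + 1) + (m - u.reg 3)
      omega
    · have hc' := fun hh => Expr.eval_and_ne_zero.2 hh hc
      simp only [Expr.eval_eq_ne_zero, Expr.eval_lt_ne_zero] at hc'
      simp only [Expr.eval, hu0, hu1] at hc'
      simp only [Memory.setReg_arr, Memory.setReg_reg, Expr.eval, if_true]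
      refine ⟨⟨hph, hsize, fun e he hem hen => ?_⟩, by omega⟩
      by_cases hel : e < u.reg 3
      · exact hpass e hel hem hen
      · obtain rfl : e = u.reg 3 := by omega
        by_contra hlt
        exact hc' ⟨hen, by omega⟩
    · simp only [Expr.and, Expr.cost]
      omega
  · have hpot : potential n m (t.arr 0) (t.arr 1) ≤ m * (2 * m + 3) := potential_le ht
    have h1 := Nat.mul_le_mul_right (m + 1) hpot
    simp only [Memory.setReg_arr, Memory.setReg_reg, Expr.eval, if_true, Expr.cost]
    refine Nat.add_le_add (Nat.mul_le_mul ?_ ?_) le_rfl <;> omega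
  · have hu1 : u.reg 1 = m := by rw [hfu.reg 1 rfl]; simpa [hm] using hf.reg 1 rfl
    have hge : ¬ u.reg 3 < m := fun h => Expr.eval_lt_ne_zero.2 (by simpa [Expr.eval, hu1]) hu.2
    exact ⟨hu.1.1, fun e he => hu.1.2.2 e (by omega) he, hu.1.2.1⟩

/-- Compute a Lorenz dominating partial allocation, by phases with growing truncation. -/
def partition : Prog :=
  .seq (forLoop 6 (.reg 1) (.write 0 (.reg 6) (.reg 0)))
    (forLoop 2 (.add (.reg 1) (.const 1)) phase)

def partitionCost (n m : ℕ) : ℕ := forCost 1 3 m + forCost 3 (phaseCost n m) (m + 1)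

theorem partition_runs (hv : ∀ i, IsMatroidRank (v i)) {s : Memory} (hn : s.reg 0 = n)
    (hm : s.reg 1 = m) :
    Runs (valueOracle v) partition s (partitionCost n m) fun t =>
      IsDominating v (t.arr 0) ∧ ∃ R, IsCertificate v (t.arr 0) m R := by
  refine .mono (.seq (.mono (.forLoop (N := m) (B := 3)
    (fun j t => ∀ e < j, t.arr 0 e = n) rfl ?_ ?_ ?_) le_rfl fun t hf ht _ =>
      .forLoop (N := m + 1) (B := phaseCost n m) (fun j t => (∀ e < m, t.arr 0 e ≤ n) ∧
        (∀ i < n, rank v i (bundle m (t.arr 0) i) = (bundle m (t.arr 0) i).card ∧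
          (bundle m (t.arr 0) i).card ≤ j) ∧
        (∀ k < j, ∀ B : Bundles n m, IsAllocation B → ∑ i : Fin n, min (rank v i (B i)) k ≤
          ∑ i : Fin n, min (bundle m (t.arr 0) i).card k) ∧
        (0 < j → ∃ R, IsCertificate v (t.arr 0) (j - 1) R)) rfl ?_ ?_ ?_)) le_rfl
    fun t _ ⟨h1, h2, h3, h4⟩ =>
      ⟨⟨h1, fun i hi => (h2 i hi).1, fun k hk => h3 k (by omega)⟩, h4 (by omega)⟩
  · intro t ht
    simpa [Expr.eval, hm] using ht.reg 1 rfl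
  · simp
  · intro j hj t ht htj hI
    refine .write ?_
    intro e he
    have h0 : t.reg 0 = n := by rw [ht.reg 0 rfl, hn]
    simp only [Expr.eval, Memory.setReg_arr, Memory.setArr_arr, if_true, htj, h0,
      Function.update_apply]
    split_ifs with hej
    · rfl
    · exact hI e (by omega)
  · intro u hu
    simp [Expr.eval, hu.reg 1 rfl, hf.reg 1 rfl, hm]
  · have hempty : ∀ i < n, bundle m (t.arr 0) i = ∅ := by
      intro i hi
      refine Finset.eq_empty_of_forall_notMem fun e he => ?_
      rw [mem_bundle, ht e e.2] at he
      omega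
    refine ⟨fun e he => (ht e he).le, fun i hi => ?_, fun k hk => by omega, fun h => by omega⟩
    simp only [Memory.setReg_arr]
    rw [hempty i hi]
    simp [(isNatRank_rank hv i).empty]
  · intro j hj u hfu huj ⟨h1, h2, h3, _⟩
    have hu0 : u.reg 0 = n := by rw [hfu.reg 0 rfl, hf.reg 0 rfl, hn]
    have hu1 : u.reg 1 = m := by rw [hfu.reg 1 rfl, hf.reg 1 rfl, hm]
    refine (phase_runs hv hu0 hu1 h1 (huj ▸ h2)).mono le_rfl fun w _ ⟨hph, hend, hsize⟩ => ?_
    rw [huj] at hph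
    simp only [Memory.setReg_arr]
    obtain ⟨R, hR⟩ := hph.exists_certificate hv hend
    refine ⟨hph.own_le, fun i hi => ?_, fun k hk B hB => ?_, fun _ => ⟨R, hR⟩⟩
    · have := hph.indep hv hi
      omega
    · rcases Nat.lt_succ_iff_lt_or_eq.1 hk with hk | rfl
      -- Bundles only grow, so that dominance at the earlier truncations persists.
      · exact (h3 k hk B hB).trans (Finset.sum_le_sum fun i _ =>
          min_le_min_right k (hsize i i.2))
      · refine (hR.sum_min_rank_le hv hph.own_le hB).trans (Finset.sum_le_sum fun i _ => ?_)
        have := (hph.indep hv i.2).2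
        omega

/-- The indicator of the bundle of agent `reg 4` together with all the unassigned items. -/
def completeIndicator : Expr :=
  .add (.eq (.read 0 (.reg 6)) (.reg 4)) (.eq (.read 0 (.reg 6)) (.reg 0))

/-- Set register `9` to `0` if some agent values the bundle of agent `reg 4` with the unassigned
items more than agent `reg 4` does, and to `1` otherwise. -/
def checkAgent : Prog :=
  .seq (fill completeIndicator) (.seq (.query 7 (.reg 4) 2) (.seq (.assign 9 (.const 1))
    (forLoop 5 (.reg 0) (.seq (.query 8 (.reg 5) 2)
      (.branch (.lt (.reg 7) (.reg 8)) (.assign 9 (.const 0)) .skip)))))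

def checkAgentCost (n m : ℕ) : ℕ :=
  fillCost completeIndicator.cost m + (2 + (2 + forCost 1 20 n))

/-- Nobody values the bundle of agent `j`, completed with the unassigned items, more than `j`. -/
def CanComplete (v : Profile n m) (own : ℕ → ℕ) (j : ℕ) : Prop :=
  ∀ i < n, rank v i (bundle m (complete n own j) j) ≤ rank v j (bundle m (complete n own j) j)

theorem checkAgent_runs {s : Memory} (hn : s.reg 0 = n) (hm : s.reg 1 = m) :
    Runs (valueOracle v) checkAgent s (checkAgentCost n m) fun t =>
      t.reg 9 ≠ 0 ↔ CanComplete v (s.arr 0) (s.reg 4) := by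
  have hfill := fill_runs (O := valueOracle v) (m := m) (s := s) (b := completeIndicator)
    (f := fun y => (if s.arr 0 y = s.reg 4 then 1 else 0) + if s.arr 0 y = n then 1 else 0) hm (by
      intro t ht
      simp only [completeIndicator, Expr.eval, ht.reg 4 rfl, ht.reg 0 rfl, ht.arr 0 rfl, hn])
  refine .mono (.seq (hfill.mono le_rfl fun t hf ht _ => .seq (B₁ := 2) (.query fun hq =>
    .seq (B₁ := 2) (.assign fun ha => .forLoop (N := n) (B := 20) (fun j u => u.reg 9 ≠ 0 ↔
      ∀ i < j, rank v i (bundle m (complete n (s.arr 0) (s.reg 4)) (s.reg 4)) ≤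
        rank v (s.reg 4) (bundle m (complete n (s.arr 0) (s.reg 4)) (s.reg 4))) rfl ?_ ?_ ?_))))
    le_rfl fun t _ ht => ht
  · intro u hu
    simp [Expr.eval, hu.reg 0 rfl, hf.reg 0 rfl, hn]
  · simp [Expr.eval]
  · intro j hj u hu huj hI
    have hset : (Finset.univ.filter fun e : Fin m => t.arr 2 e ≠ 0) =
        bundle m (complete n (s.arr 0) (s.reg 4)) (s.reg 4) := by
      ext y
      simp only [Finset.mem_filter, Finset.mem_univ, true_and, ht.1 y y.2, mem_bundle, complete]
      split_ifs <;> simp_all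
    have h2 : u.arr 2 = t.arr 2 := hu.arr 2 rfl
    have h7 : u.reg 7 = rank v (s.reg 4)
        (bundle m (complete n (s.arr 0) (s.reg 4)) (s.reg 4)) := by
      rw [hu.reg 7 rfl, ← hset]
      simp [Expr.eval, valueOracle_eq_rank, hf.reg 4 rfl]
    have h8 : valueOracle v j (u.arr 2) = rank v j
        (bundle m (complete n (s.arr 0) (s.reg 4)) (s.reg 4)) := by
      rw [h2, valueOracle_eq_rank, hset]
    refine .mono (.seq (B₁ := 2) (.query fun _ => .branch (Q := _) (fun hb => .assign ?_)
      fun hb => .skip ?_)) (by decide) fun t _ ht => ht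
    · rw [Expr.eval_lt_ne_zero] at hb
      simp only [Expr.eval, Memory.setReg_reg, Nat.reduceEqDiff, if_false, if_true, huj, h7,
        h8] at hb
      simp only [Expr.eval, Memory.setReg_reg, Nat.reduceEqDiff, if_false, if_true]
      refine ⟨fun h => absurd rfl h, fun h => ?_⟩
      have := h j (by omega)
      omega
    · have hb' := fun hh => Expr.eval_lt_ne_zero.2 hh hb
      simp only [Expr.eval, Memory.setReg_reg, Nat.reduceEqDiff, if_false, if_true, huj, h7,
        h8] at hb'
      simp only [Memory.setReg_reg, Nat.reduceEqDiff, if_false]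
      rw [hI]
      refine ⟨fun h i hi => ?_, fun h i hi => h i (by omega)⟩
      rcases Nat.lt_succ_iff_lt_or_eq.1 hi with hi | rfl
      · exact h i hi
      · exact not_lt.1 hb'

/-- Give all unassigned items to an agent who passes the check. -/
def completion : Prog :=
  .seq (forLoop 4 (.reg 0) (.seq checkAgent (.branch (.reg 9) (.assign 3 (.reg 4)) .skip)))
    (forLoop 6 (.reg 1) (.branch (.eq (.read 0 (.reg 6)) (.reg 0))
      (.write 0 (.reg 6) (.reg 3)) .skip))

def completionCost (n m : ℕ) : ℕ := forCost 1 (checkAgentCost n m + 20) n + forCost 1 20 m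

theorem completion_runs {s : Memory} (hn : s.reg 0 = n) (hm : s.reg 1 = m)
    (h : ∃ J < n, CanComplete v (s.arr 0) J) :
    Runs (valueOracle v) completion s (completionCost n m) fun t =>
      ∃ J < n, CanComplete v (s.arr 0) J ∧ ∀ e < m, t.arr 0 e = complete n (s.arr 0) J e := by
  refine .mono (.seq (.mono (.forLoop (N := n) (B := checkAgentCost n m + 20)
    (fun j t => (∃ i < j, CanComplete v (s.arr 0) i) →
      t.reg 3 < n ∧ CanComplete v (s.arr 0) (t.reg 3)) rfl ?_ ?_ ?_) le_rfl fun t hf ht _ =>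
    .mono (.forLoop (N := m) (B := 20) (fun j u => (∀ e < j, u.arr 0 e =
      complete n (s.arr 0) (t.reg 3) e) ∧ ∀ e, j ≤ e → u.arr 0 e = s.arr 0 e) rfl ?_ ?_ ?_)
      le_rfl fun u hu hI => ⟨t.reg 3, (ht h).1, (ht h).2, hI.1⟩)) le_rfl fun t _ ht => ht
  · intro t ht
    simpa [Expr.eval, hn] using ht.reg 0 rfl
  · rintro ⟨i, hi, -⟩
    omega
  · intro j hj t hf htj hI
    refine .mono (.seq ((checkAgent_runs (v := v) (n := n) (m := m)
      (by simpa [hn] using hf.reg 0 rfl) (by simpa [hm] using hf.reg 1 rfl)).mono le_rfl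
      fun u hu hc _ => .branch (Q := _) (fun hb => .assign ?_) fun hb => .skip ?_)) ?_
      fun t _ ht => ht
    · intro _
      have h4 : u.reg 4 = j := by rw [hu.reg 4 rfl, htj]
      have := hc.1 hb
      rw [hf.arr 0 rfl, htj] at this
      simpa [Expr.eval, h4] using ⟨hj, this⟩
    · rintro ⟨i, hi, hci⟩
      have h3 : u.reg 3 = t.reg 3 := hu.reg 3 rfl
      simp only [Memory.setReg_reg, Nat.reduceEqDiff, if_false, h3]
      refine hI ⟨i, ?_, hci⟩
      rcases Nat.lt_succ_iff_lt_or_eq.1 hi with hi | rfl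
      · exact hi
      · refine absurd hb (hc.2 ?_)
        rwa [hf.arr 0 rfl, htj]
    · simp [Expr.cost]
  · intro u hu
    simp [Expr.eval, hu.reg 1 rfl, hf.reg 1 rfl, hm]
  · refine ⟨fun e he => by omega, fun e _ => ?_⟩
    simp [hf.arr 0 rfl]
  · intro j hj u hu huj ⟨h1, h2⟩
    have h0 : u.reg 0 = n := by rw [hu.reg 0 rfl, hf.reg 0 rfl, hn]
    have h3 : u.reg 3 = t.reg 3 := hu.reg 3 rfl
    have hj' := h2 j le_rfl
    refine .mono (.branch (Q := _) (fun hb => .write ?_) fun hb => .skip ?_) (by decide)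
      fun t _ ht => ht
    · rw [Expr.eval_eq_ne_zero] at hb
      simp only [Expr.eval, huj, h0, hj'] at hb
      simp only [Expr.eval, Memory.setReg_arr, Memory.setArr_arr, if_true, huj, h3,
        Function.update_apply]
      refine ⟨fun e he => ?_, fun e he => ?_⟩
      · split_ifs with hej
        · simp [complete, hej, hb]
        · exact h1 e (by omega)
      · rw [if_neg (by omega)]
        exact h2 e (by omega)
    · have hb' := fun hh => Expr.eval_eq_ne_zero.2 hh hb
      simp only [Expr.eval, huj, h0, hj'] at hb'
      simp only [Memory.setReg_arr]
      refine ⟨fun e he => ?_, fun e he => h2 e (by omega)⟩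
      rcases Nat.lt_succ_iff_lt_or_eq.1 he with he | rfl
      · exact h1 e he
      · rw [hj', complete, if_neg hb']

/-- The algorithm. -/
def algorithm : Prog := .seq partition completion

theorem algorithm_runs (hn : 0 < n) (hv : ∀ i, IsMatroidRank (v i)) :
    Runs (valueOracle v) algorithm (initialMemory n m) (partitionCost n m + completionCost n m)
      fun t => ∃ A, Outputs t A ∧ IsMaxNSW v A ∧ IsMaxUSW v A ∧
        IsEquitableConvertibleEnvyFreeable v A := by
  refine .seq ((partition_runs hv rfl rfl).mono le_rfl fun t hf ⟨hdom, R, hR⟩ _ =>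
    (completion_runs (v := v) (hf.reg 0 rfl) (hf.reg 1 rfl)
      (exists_completion hn hv hR hdom.indep)).mono le_rfl fun u _ ⟨J, hJn, hJ, hu⟩ =>
        ⟨_, fun i e => ?_, hdom.complete_spec hv hJn hJ⟩)
  rw [mem_bundle, hu e e.2]

/-! ### The polynomial time bound -/

/-- `f` is bounded by a polynomial in the sum of its arguments. -/
def IsPolyBounded (f : ℕ → ℕ → ℕ) : Prop :=
  ∃ q : Polynomial ℕ, ∀ n m, f n m ≤ q.eval (n + m)

theorem isPolyBounded_const (c : ℕ) : IsPolyBounded fun _ _ => c :=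
  ⟨Polynomial.C c, by simp⟩

theorem isPolyBounded_fst : IsPolyBounded fun n _ => n := ⟨Polynomial.X, by simp⟩

theorem isPolyBounded_snd : IsPolyBounded fun _ m => m := ⟨Polynomial.X, by simp⟩

theorem IsPolyBounded.add {f g : ℕ → ℕ → ℕ} (hf : IsPolyBounded f) (hg : IsPolyBounded g) :
    IsPolyBounded fun n m => f n m + g n m := by
  obtain ⟨p, hp⟩ := hf
  obtain ⟨q, hq⟩ := hg
  exact ⟨p + q, fun n m => by simpa using Nat.add_le_add (hp n m) (hq n m)⟩

theorem IsPolyBounded.mul {f g : ℕ → ℕ → ℕ} (hf : IsPolyBounded f) (hg : IsPolyBounded g) :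
    IsPolyBounded fun n m => f n m * g n m := by
  obtain ⟨p, hp⟩ := hf
  obtain ⟨q, hq⟩ := hg
  exact ⟨p * q, fun n m => by simpa using Nat.mul_le_mul (hp n m) (hq n m)⟩

theorem isPolyBounded_algorithm :
    IsPolyBounded fun n m => partitionCost n m + completionCost n m := by
  simp only [partitionCost, completionCost, phaseCost, searchCost, testCost, checkAgentCost,
    fillCost, forCost]
  repeat' first
    | exact isPolyBounded_fst
    | exact isPolyBounded_snd
    | exact isPolyBounded_const _
    | refine IsPolyBounded.add ?_ ?_
    | refine IsPolyBounded.mul ?_ ?_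

theorem polyTimeComputable_of_forall (Good : ∀ {n m : ℕ}, Profile n m → Bundles n m → Prop)
    (h : ∀ {n m : ℕ} (v : Profile n m) (A : Bundles n m), IsMaxNSW v A → IsMaxUSW v A →
      IsEquitableConvertibleEnvyFreeable v A → Good v A) : PolyTimeComputable Good := by
  obtain ⟨q, hq⟩ := isPolyBounded_algorithm
  refine ⟨algorithm, q, fun n m hn v hv => ?_⟩
  obtain ⟨t, k, he, hk, A, ho, h1, h2, h3⟩ := algorithm_runs hn hv
  exact ⟨t, k, A, he, hk.trans (hq n m), ho, h1.1, h v A h1 h2 h3⟩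

end FairDivision

theorem mainTheorem2 :
    (∀ (n m : ℕ), 0 < n → ∀ v : FairDivision.Profile n m,
      (∀ i, FairDivision.IsMatroidRank (v i)) →
        (∃ A, FairDivision.IsMaxNSW v A ∧ FairDivision.IsEquitableConvertibleEnvyFreeable v A) ∧
        (∃ A, FairDivision.IsMaxUSW v A ∧ FairDivision.IsEquitableConvertibleEnvyFreeable v A)) ∧
    FairDivision.PolyTimeComputable (fun v A =>
      FairDivision.IsMaxNSW v A ∧ FairDivision.IsEquitableConvertibleEnvyFreeable v A) ∧
    FairDivision.PolyTimeComputable (fun v A =>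
      FairDivision.IsMaxUSW v A ∧ FairDivision.IsEquitableConvertibleEnvyFreeable v A) := by
  refine ⟨fun n m hn v hv => ?_,
    FairDivision.polyTimeComputable_of_forall _ fun v A h1 _ h3 => ⟨h1, h3⟩,
    FairDivision.polyTimeComputable_of_forall _ fun v A _ h2 h3 => ⟨h2, h3⟩⟩
  obtain ⟨_, _, _, _, A, _, h1, h2, h3⟩ := FairDivision.algorithm_runs (m := m) hn hv
  exact ⟨⟨A, h1, h3⟩, ⟨A, h2, h3⟩⟩
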